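/- Let $k\ge 2$. Notation. A \emph{generalized odd Durfee symbol} for $n\ge 1$ consists of an integer $t\ge 0$, two partitions $\lambda,\mu$ into distinct odd parts of size at most $2t-1$, and two rows (top and bottom), each of which is a partition into odd parts of size at most $2t+1$, such that $n$ is the sum of all entries of the two rows, of all parts of $\lambda$ and of $\mu$, and of $2t+1$. A number $2x-1$ with $1\le x\le t$ is \emph{missing} from $\lambda$ (resp. $\mu$) if it does not occur in it. A \emph{$k$-marked generalized odd Durfee symbol} for $n$ is a generalized odd Durfee symbol for $n$ in which each entry of the two rows carries a subscript from $\{1,\dots,k\}$ such that (1) in each row the sequence of parts and the sequence of subscripts are non-increasing; (2) each of the subscripts $1,\dots,k-1$ occurs at least once in the top row; (3) if $M_i$ is the largest part with subscript $i$ in the top row ($1\le i\le k-1$), and $M_0:=1$, $M_k:=2t+1$, then every part with subscript $i$ in the bottom row lies in $[M_{i-1},M_i]$ ($1\le i\le k$). For such a symbol let $\tau_i$ (resp. $\beta_i$) be the number of entries with subscript $i$ in the top (resp. bottom) row, and let the \emph{$i$th rank} be $\rho_i=\tau_i-\beta_i-1$ for $1\le i<k$ and $\rho_k=\tau_k-\beta_k$.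 Let $\mathcal D_k^o(r,s,m_1,\dots,m_k,n)$ be the number of $k$-marked generalized odd Durfee symbols for $n$ with $r$ missing parts in $\lambda$, $s$ missing parts in $\mu$, and $\rho_i=m_i$ for all $i$. Write $(z;q)_n=\prod_{j=0}^{n-1}(1-zq^j)$, $(z;q)_\infty=\prod_{j\ge 0}(1-zq^j)$ and $(z,w;q)_n=(z;q)_n(w;q)_n$ for $0\le n\le\infty$. Theorem. The numbers $\mathcal D_k^o(r,s,m_1,\dots,m_k,n)$ are finite, and $$\sum_{m_1,\dots,m_k\in\mathbb Z}\ \sum_{r,s,n\ge 0}\mathcal D_k^o(r,s,m_1,\dots,m_k,n)\,x_1^{m_1}\cdots x_k^{m_k}a^rb^sq^n =\frac{(-aq,-bq;q^2)_\infty}{(q^2,abq^2;q^2)_\infty}\sum_{n\ge 0}\frac{(1-q^{4n+2})(-q/a,-q/b;q^2)_n(-ab)^nq^{n^2+(2k+1)n+k}}{(-aq,-bq;q^2)_{n+1}\prod_{i=1}^k(1-x_iq^{2n+1})(1-q^{2n+1}/x_i)}$$ as an identity of formal power series in $q$ (all sums converging coefficientwise) over $\mathbb Z[a^{\pm1},b^{\pm1},x_1^{\pm1},\dots,x_k^{\pm1}]$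 with indeterminates $a,b,x_1,\dots,x_k$; equivalently, over every commutative ring $R$ with arbitrary units $a,b,x_1,\dots,x_k$ of $R$. -/

import Mathlib

open scoped PowerSeries.WithPiTopology

/-- A `k`-marked generalized odd Durfee symbol. An entry of a row is a pair `(p, c)`, where `p` is
the part and `c` its subscript (colour); the subscripts are `1, …, k`. -/
@[ext]
structure MarkedOddDurfeeSymbol (k : ℕ) where
  /-- the third subscript of the symbol -/
  t : ℕ
  /-- the first subscript: a partition into distinct odd parts of size at most `2t - 1` -/
  lam : Finset ℕ
  /-- the second subscript: a partition into distinct odd parts of size at most `2t - 1` -/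
  mu : Finset ℕ
  /-- the top row -/
  top : List (ℕ × ℕ)
  /-- the bottom row -/
  bot : List (ℕ × ℕ)
  lam_odd : ∀ p ∈ lam, Odd p
  lam_lt : ∀ p ∈ lam, p < 2 * t
  mu_odd : ∀ p ∈ mu, Odd p
  mu_lt : ∀ p ∈ mu, p < 2 * t
  top_odd : ∀ e ∈ top, Odd e.1
  top_le : ∀ e ∈ top, e.1 ≤ 2 * t + 1
  bot_odd : ∀ e ∈ bot, Odd e.1
  bot_le : ∀ e ∈ bot, e.1 ≤ 2 * t + 1
  top_color : ∀ e ∈ top, 1 ≤ e.2 ∧ e.2 ≤ k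
  bot_color : ∀ e ∈ bot, 1 ≤ e.2 ∧ e.2 ≤ k
  /-- parts and subscripts of the top row are non-increasing -/
  top_sorted : top.Pairwise fun e f => f.1 ≤ e.1 ∧ f.2 ≤ e.2
  /-- parts and subscripts of the bottom row are non-increasing -/
  bot_sorted : bot.Pairwise fun e f => f.1 ≤ e.1 ∧ f.2 ≤ e.2
  /-- each of the subscripts `1, …, k - 1` occurs in the top row -/
  top_occurs : ∀ c, 1 ≤ c → c < k → ∃ e ∈ top, e.2 = c
  /-- A part of the bottom row with subscript `c` is at least the largest part of the top row with
  subscript `c - 1` (no condition beyond `1 ≤ p` if `c = 1`). -/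
  bot_lower : ∀ e ∈ bot, ∀ f ∈ top, f.2 + 1 = e.2 → f.1 ≤ e.1
  /-- A part of the bottom row with subscript `c < k` is at most the largest part of the top row
  with subscript `c` (for `c = k` the bound is `2t + 1`, see `bot_le`). -/
  bot_upper : ∀ e ∈ bot, e.2 < k → ∃ f ∈ top, f.2 = e.2 ∧ e.1 ≤ f.1

namespace MarkedOddDurfeeSymbol

variable {k : ℕ}

/-- The number that the symbol is a symbol for. -/
def size (δ : MarkedOddDurfeeSymbol k) : ℕ :=
  (δ.top.map Prod.fst).sum + (δ.bot.map Prod.fst).sum + ∑ p ∈ δ.lam, p + ∑ p ∈ δ.mu, p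
    + (2 * δ.t + 1)

/-- The number of missing parts of `ν`, i.e. of odd numbers `2x - 1` with `1 ≤ x ≤ t` that do not
occur in `ν`. -/
def missing (t : ℕ) (ν : Finset ℕ) : ℕ :=
  ((Finset.Icc 1 t).filter fun x => 2 * x - 1 ∉ ν).card

/-- The number of entries of a row with subscript `c`. -/
def countColor (row : List (ℕ × ℕ)) (c : ℕ) : ℕ :=
  (row.filter fun e => e.2 = c).length

/-- The `c`-th rank, for a subscript `1 ≤ c ≤ k`. -/
def rank (δ : MarkedOddDurfeeSymbol k) (c : ℕ) : ℤ :=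
  if c < k then (countColor δ.top c : ℤ) - countColor δ.bot c - 1
  else (countColor δ.top c : ℤ) - countColor δ.bot c

/-- `δ` is a symbol for `n` with `r` missing parts in `λ`, `s` missing parts in `μ`, and `i`-th rank
`mᵢ` for all `i`; the component `m i` with `i : Fin k` belongs to the subscript `i + 1`. -/
def HasStats (δ : MarkedOddDurfeeSymbol k) (r s : ℕ) (m : Fin k → ℤ) (n : ℕ) : Prop :=
  missing δ.t δ.lam = r ∧ missing δ.t δ.mu = s ∧ (∀ i : Fin k, δ.rank (i + 1) = m i) ∧ δ.size = n

end MarkedOddDurfeeSymbol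

/-- The number of `k`-marked generalized odd Durfee symbols for `n` with `r` missing parts in `λ`,
`s` missing parts in `μ` and ranks `m`. -/
noncomputable def markedOddDurfeeCount (k r s : ℕ) (m : Fin k → ℤ) (n : ℕ) : ℕ :=
  Nat.card {δ : MarkedOddDurfeeSymbol k // δ.HasStats r s m n}

/-- The finite `q`-shifted factorial `(z; q)ₙ`. -/
def qPoch {A : Type*} [CommRing A] (z q : A) (n : ℕ) : A :=
  ∏ j ∈ Finset.range n, (1 - z * q ^ j)

/-- The infinite `q`-shifted factorial `(z; q)_∞`. -/
noncomputable def qPochInf {A : Type*} [CommRing A] [TopologicalSpace A] (z q : A) : A :=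
  ∏' j : ℕ, (1 - z * q ^ j)

/-- The infinite product `(z; q)_∞` of power series converges if `q` has no constant term. -/
theorem multipliable_qPochInf {R : Type*} [CommRing R] [TopologicalSpace R] (z q : PowerSeries R)
    (hq : PowerSeries.constantCoeff q = 0) : Multipliable fun j : ℕ => 1 - z * q ^ j := by
  simp_rw [sub_eq_add_neg]
  apply PowerSeries.WithPiTopology.multipliable_one_add_of_tendsto_order_atTop_nhds_top
  refine ENat.tendsto_nhds_top_iff_natCast_lt.mpr fun n => ?_
  filter_upwards [Filter.eventually_gt_atTop n] with j hj
  rw [PowerSeries.order_neg]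
  have h1 : (1 : ℕ∞) ≤ q.order := by
    have := PowerSeries.le_order q 1 (by
      intro i hi
      have : i = 0 := by
        have : i < 1 := by exact_mod_cast hi
        omega
      subst this
      simpa using hq)
    simpa using this
  calc (n : ℕ∞) < j := by exact_mod_cast hj
    _ = j • (1 : ℕ∞) := by simp
    _ ≤ j • q.order := nsmul_le_nsmul_right h1 j
    _ ≤ (q ^ j).order := PowerSeries.le_order_pow _ _
    _ ≤ z.order + (q ^ j).order := le_add_self
    _ ≤ (z * q ^ j).order := PowerSeries.le_order_mul _ _

/-- The `n`-th term
`(1 - q^(4n+2)) (-q/a, -q/b; q²)ₙ (-ab)ⁿ q^(n²+(2k+1)n+k)`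
`  / ((-aq, -bq; q²)ₙ₊₁ ∏ᵢ (1 - xᵢ q^(2n+1)) (1 - q^(2n+1)/xᵢ))`.
Here `Ring.inverse` is the inverse of a unit; in the ring of power series in `q` the denominator is
a unit, as it has constant term `1`. -/
noncomputable def markedDurfeeTerm {A : Type*} [CommRing A] {k : ℕ} (a b : Aˣ) (x : Fin k → Aˣ)
    (q : A) (n : ℕ) : A :=
  (1 - q ^ (4 * n + 2)) * (qPoch (-q * ↑a⁻¹) (q ^ 2) n * qPoch (-q * ↑b⁻¹) (q ^ 2) n)
      * (-(a * b : A)) ^ n * q ^ (n ^ 2 + (2 * k + 1) * n + k)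
    * Ring.inverse (qPoch (-a * q) (q ^ 2) (n + 1) * qPoch (-b * q) (q ^ 2) (n + 1)
        * ∏ i, ((1 - x i * q ^ (2 * n + 1)) * (1 - q ^ (2 * n + 1) * ↑(x i)⁻¹)))

/-- The factor `(-aq, -bq; q²)_∞ / (q², abq²; q²)_∞`. In the ring of power series in `q` the
denominator is a unit, as it has constant term `1`. -/
noncomputable def markedDurfeePrefactor {A : Type*} [CommRing A] [TopologicalSpace A] (a b q : A) :
    A :=
  qPochInf (-a * q) (q ^ 2) * qPochInf (-b * q) (q ^ 2)
    * Ring.inverse (qPochInf (q ^ 2) (q ^ 2) * qPochInf (a * b * q ^ 2) (q ^ 2))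

/-- A unit of `R` as a unit (constant power series) of `R⟦q⟧`. -/
noncomputable def constUnit {R : Type*} [CommRing R] (u : Rˣ) : (PowerSeries R)ˣ :=
  Units.map (PowerSeries.C : R →+* PowerSeries R).toMonoidHom u

/-! Fix the largest parts M_c = 2n_c + 1 of the subscripts in the top row and put n_0 = 0, n_k = t.
Sortedness in the top row and condition (3) in the bottom row both say that the parts with subscript
c lie in [2n_{c-1} + 1, 2n_c + 1], where 0 = n_0 ≤ ⋯ ≤ n_k = t is an arbitrary chain. Take one copy
of each M_c with c < k out of the top row. What is left of the two rows is an arbitrary pair of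
multisets of admitted entries, since such entries can be sorted in exactly one way. The removed
copies account for the -1 in the ranks, and the summand 2t + 1 of the size acts as a k-th mark
(`symbolOfData_injective`, `symbolOfData_surjective`). Hence the generating function is Σ_t A_t B_t
β_t with A_t = ∏_{j<t} (a + q^(2j+1)), B_t the same in b, and β_t = `rowSeries` a sum over chains of
∏_c q^(2n_c+1) ∏_{j=n_{c-1}}^{n_c} 1/((1 - x_c q^(2j+1))(1 - q^(2j+1)/x_c)).

This multiple sum belongs to a Bailey pair: β_t = q^(2t) Σ_m α_m / ((q²;q²)_{t-m} (q²;q²)_{t+m+1}),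
where α_m = `rowAlpha` is a single product (`X_mul_rowSeries`). With no subscripts this is the unit
Bailey pair, a case of the q-binomial theorem (`sum_alternating_qFactorialInv`). Each new subscript
multiplies α_m by q^(2m+1)/((1 - x q^(2m+1))(1 - q^(2m+1)/x)), by the finite summation
`sum_rowFactorInv`.

Inserting this in Σ_t A_t B_t β_t and writing t = n + i, where n is the index of α, makes the sum
over i a q-Gauss sum (`qGauss`). Its value turns the contribution of n into the prefactor times the
n-th term of the theorem (`markedDurfeePrefactor_mul_term`).

All rearrangements are legitimate because the families are locally finite: only finitely many
members fail to be divisible by a given power of q. For the weights of the symbols themselves, the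
same property gives the finiteness of the counts. -/

namespace OddDurfee

open PowerSeries

/-! ### Locally finite families of power series -/

section LocallyFinite

set_option linter.unusedSectionVars false

variable {R : Type*} [CommRing R] {ι κ : Type*}

/-- A family of power series is locally finite if all but finitely many members are divisible by
any given power of the variable. -/
def LocallyFiniteFamily (f : ι → R⟦X⟧) : Prop :=
  ∀ N : ℕ, {i | ¬ (X : R⟦X⟧) ^ N ∣ f i}.Finite

theorem locallyFiniteFamily_of_forall_dvd {f : ℕ → R⟦X⟧} (h : ∀ n, X ^ n ∣ f n) :
    LocallyFiniteFamily f := fun N =>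
  (Set.finite_lt_nat N).subset fun n hn => by
    by_contra hlt
    exact hn ((pow_dvd_pow X (not_lt.mp hlt)).trans (h n))

theorem LocallyFiniteFamily.of_finite [Finite ι] (f : ι → R⟦X⟧) : LocallyFiniteFamily f :=
  fun _ => Set.toFinite _

theorem LocallyFiniteFamily.mul {f : ι → R⟦X⟧} {g : κ → R⟦X⟧} (hf : LocallyFiniteFamily f)
    (hg : LocallyFiniteFamily g) : LocallyFiniteFamily fun p : ι × κ => f p.1 * g p.2 :=
  fun N => ((hf N).prod (hg N)).subset fun _ hp =>
    ⟨fun h => hp (h.mul_right _), fun h => hp (h.mul_left _)⟩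

theorem LocallyFiniteFamily.comp_injective {f : ι → R⟦X⟧} (hf : LocallyFiniteFamily f)
    {e : κ → ι} (he : Function.Injective e) : LocallyFiniteFamily (f ∘ e) :=
  fun N => (hf N).preimage he.injOn

theorem LocallyFiniteFamily.const_mul {f : ι → R⟦X⟧} (hf : LocallyFiniteFamily f) (c : R⟦X⟧) :
    LocallyFiniteFamily fun i => c * f i :=
  fun N => (hf N).subset fun _ hi h => hi (h.mul_left _)

theorem LocallyFiniteFamily.sigma {κ : ι → Type*} {f : (Σ i, κ i) → R⟦X⟧}
    (hf : ∀ i, LocallyFiniteFamily fun k => f ⟨i, k⟩)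
    (h : ∀ N : ℕ, {i | ∃ k, ¬ (X : R⟦X⟧) ^ N ∣ f ⟨i, k⟩}.Finite) : LocallyFiniteFamily f := by
  intro N
  refine ((h N).biUnion fun i _ => (hf i N).image (Sigma.mk i)).subset ?_
  rintro ⟨i, k⟩ hik
  simp only [Set.mem_iUnion, Set.mem_image, Set.mem_ofPred_eq]
  exact ⟨i, ⟨k, hik⟩, k, hik, rfl⟩

theorem isUnit_one_sub {v : R⟦X⟧} (h : X ∣ v) : IsUnit (1 - v) := by
  rw [isUnit_iff_constantCoeff, map_sub, X_dvd_iff.mp h]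
  simp

variable [TopologicalSpace R] [DiscreteTopology R]

/-- As R is discrete, it suffices that each coefficient has finite support over the family; degree d
sees only members not divisible by X^(d+1). -/
theorem LocallyFiniteFamily.summable {f : ι → R⟦X⟧} (hf : LocallyFiniteFamily f) :
    Summable f := by
  rw [WithPiTopology.summable_iff_summable_coeff]
  intro d
  apply summable_of_hasFiniteSupport
  refine (hf (d + 1)).subset fun i hi h => hi ?_
  exact X_pow_dvd_iff.mp h d (Nat.lt_succ_self d)

/-- `f` is a locally finite family with sum `S`. -/
structure LocallyFiniteSum (f : ι → R⟦X⟧) (S : R⟦X⟧) : Prop where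
  locallyFinite : LocallyFiniteFamily f
  hasSum : HasSum f S

theorem LocallyFiniteFamily.sum {f : ι → R⟦X⟧} (hf : LocallyFiniteFamily f) :
    LocallyFiniteSum f (∑' i, f i) := ⟨hf, hf.summable.hasSum⟩

namespace LocallyFiniteSum

theorem of_fintype [Fintype ι] (f : ι → R⟦X⟧) : LocallyFiniteSum f (∑ i, f i) :=
  ⟨.of_finite f, hasSum_fintype f⟩

theorem mul {f : ι → R⟦X⟧} {g : κ → R⟦X⟧} {S T : R⟦X⟧} (hf : LocallyFiniteSum f S)
    (hg : LocallyFiniteSum g T) : LocallyFiniteSum (fun p : ι × κ => f p.1 * g p.2) (S * T) :=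
  have h := hf.1.mul hg.1
  ⟨h, hf.2.mul hg.2 h.summable⟩

theorem const_mul {f : ι → R⟦X⟧} {S : R⟦X⟧} (hf : LocallyFiniteSum f S) (c : R⟦X⟧) :
    LocallyFiniteSum (fun i => c * f i) (c * S) :=
  ⟨hf.1.const_mul c, hf.2.mul_left c⟩

theorem equiv {f : ι → R⟦X⟧} {S : R⟦X⟧} (hf : LocallyFiniteSum f S) (e : κ ≃ ι) :
    LocallyFiniteSum (f ∘ e) S :=
  ⟨hf.1.comp_injective e.injective, e.hasSum_iff.mpr hf.2⟩

/-- Summation over fibres presupposes a total sum. Local finiteness provides one, and uniqueness of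
limits identifies it with S. -/
theorem sigma {κ : ι → Type*} {f : (Σ i, κ i) → R⟦X⟧} {g : ι → R⟦X⟧} {S : R⟦X⟧}
    (hf : ∀ i, LocallyFiniteSum (fun k => f ⟨i, k⟩) (g i))
    (h : ∀ N : ℕ, {i | ∃ k, ¬ (X : R⟦X⟧) ^ N ∣ f ⟨i, k⟩}.Finite) (hg : HasSum g S) :
    LocallyFiniteSum f S := by
  have hlf : LocallyFiniteFamily f := .sigma (fun i => (hf i).1) h
  refine ⟨hlf, ?_⟩
  have h1 := hlf.summable.hasSum
  have h2 := h1.sigma fun i => (hf i).2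
  rw [hg.unique h2]
  exact h1

end LocallyFiniteSum

theorem X_pow_dvd_of_hasSum {f : ι → R⟦X⟧} {S : R⟦X⟧} (h : HasSum f S) {N : ℕ}
    (hN : ∀ i, X ^ N ∣ f i) : X ^ N ∣ S := by
  rw [X_pow_dvd_iff]
  intro m hm
  have h1 := (WithPiTopology.hasSum_iff_hasSum_coeff R).mp h m
  have h2 : (fun i => coeff m (f i)) = fun _ => 0 := by
    funext i
    exact X_pow_dvd_iff.mp (hN i) m hm
  rw [h2] at h1
  exact h1.unique hasSum_zero

theorem tendsto_of_X_pow_dvd_sub {s : ℕ → R⟦X⟧} {L : R⟦X⟧} (h : ∀ N, X ^ N ∣ s N - L) :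
    Filter.Tendsto s Filter.atTop (nhds L) := by
  rw [WithPiTopology.tendsto_iff_coeff_tendsto]
  intro d
  apply tendsto_const_nhds.congr'
  filter_upwards [Filter.eventually_gt_atTop d] with N hN
  have := X_pow_dvd_iff.mp (h N) d hN
  rw [map_sub, sub_eq_zero] at this
  exact this.symm

theorem locallyFiniteSum_geometric {v : R⟦X⟧} (h : X ∣ v) :
    LocallyFiniteSum (fun n : ℕ => v ^ n) (Ring.inverse (1 - v)) := by
  have hlf : LocallyFiniteFamily fun n : ℕ => v ^ n :=
    locallyFiniteFamily_of_forall_dvd fun n => pow_dvd_pow_of_dvd h n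
  have h1 := WithPiTopology.tsum_pow_mul_one_sub_of_constantCoeff_eq_zero (X_dvd_iff.mp h)
  have h2 : Ring.inverse (1 - v) = ∑' n : ℕ, v ^ n := by
    calc Ring.inverse (1 - v) = (∑' n : ℕ, v ^ n) * (1 - v) * Ring.inverse (1 - v) := by
          rw [h1, one_mul]
      _ = _ := by rw [mul_assoc, Ring.mul_inverse_cancel _ (isUnit_one_sub h), mul_one]
  rw [h2]
  exact hlf.sum

end LocallyFinite

/-! ### Generating functions of multisets -/

section Multiset

variable {R : Type*} [CommRing R] [TopologicalSpace R] [DiscreteTopology R] {α : Type*}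

/-- A multiset supported on `insert a s` is determined by the multiplicity of `a` and by its other
elements. -/
def multisetInsertEquiv [DecidableEq α] {s : Finset α} {a : α} (ha : a ∉ s) :
    {m : Multiset α // ∀ e ∈ m, e ∈ insert a s} ≃ ℕ × {m : Multiset α // ∀ e ∈ m, e ∈ s} where
  toFun m := (m.1.count a, ⟨m.1.filter (· ≠ a), fun e he => by
    obtain ⟨h1, h2⟩ := Multiset.mem_filter.mp he
    exact (Finset.mem_insert.mp (m.2 e h1)).resolve_left h2⟩)
  invFun p := ⟨Multiset.replicate p.1 a + p.2.1, fun e he => by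
    rcases Multiset.mem_add.mp he with h | h
    · exact Finset.mem_insert.mpr (.inl (Multiset.eq_of_mem_replicate h))
    · exact Finset.mem_insert.mpr (.inr (p.2.2 e h))⟩
  left_inv m := by
    apply Subtype.ext
    change Multiset.replicate (m.1.count a) a + m.1.filter (· ≠ a) = m.1
    rw [← Multiset.filter_eq', Multiset.filter_add_not]
  right_inv p := by
    obtain ⟨n, m, hm⟩ := p
    have h0 : a ∉ m := fun h => ha (hm a h)
    ext1
    · change (Multiset.replicate n a + m).count a = n
      rw [Multiset.count_add, Multiset.count_replicate_self, Multiset.count_eq_zero_of_notMem h0,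
        add_zero]
    · apply Subtype.ext
      change (Multiset.replicate n a + m).filter (· ≠ a) = m
      rw [Multiset.filter_add, Multiset.filter_eq_nil.mpr, zero_add, Multiset.filter_eq_self]
      · rintro e he rfl
        exact h0 he
      · intro e he
        simpa using Multiset.eq_of_mem_replicate he

/-- One geometric series for the multiplicity of each element of s, multiplied together by induction
on s. -/
theorem locallyFiniteSum_multiset (v : α → R⟦X⟧) (s : Finset α) (hv : ∀ e ∈ s, X ∣ v e) :
    LocallyFiniteSum (fun m : {m : Multiset α // ∀ e ∈ m, e ∈ s} => (m.1.map v).prod)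
      (∏ e ∈ s, Ring.inverse (1 - v e)) := by
  classical
  induction s using Finset.induction_on with
  | empty =>
    let _ : Unique {m : Multiset α // ∀ e ∈ m, e ∈ (∅ : Finset α)} :=
      { default := ⟨0, by simp⟩
        uniq := fun m => Subtype.ext (Multiset.eq_zero_of_forall_notMem fun e he => by
          simpa using m.2 e he) }
    have := LocallyFiniteSum.of_fintype
      (fun m : {m : Multiset α // ∀ e ∈ m, e ∈ (∅ : Finset α)} => (m.1.map v).prod)
    rw [Fintype.sum_unique] at this
    have h0 : (default : {m : Multiset α // ∀ e ∈ m, e ∈ (∅ : Finset α)}).1 = 0 := rfl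
    simpa [h0] using this
  | insert a s ha ih =>
    rw [Finset.prod_insert ha]
    have h1 := (locallyFiniteSum_geometric (hv a (Finset.mem_insert_self a s))).mul
      (ih fun e he => hv e (Finset.mem_insert_of_mem he))
    have h2 := h1.equiv (multisetInsertEquiv ha)
    convert h2 using 1
    funext m
    have hm : m.1 = Multiset.replicate (m.1.count a) a + m.1.filter (· ≠ a) := by
      rw [← Multiset.filter_eq', Multiset.filter_add_not]
    conv_lhs => rw [hm, Multiset.map_add, Multiset.prod_add, Multiset.map_replicate,
      Multiset.prod_replicate]
    rfl

end Multiset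

end OddDurfee

namespace OddDurfee

open PowerSeries

/-! ### The q-binomial theorem and the unit Bailey pair -/

section BaileyPair

variable {R : Type*} [CommRing R]

theorem isUnit_one_sub_mul_X_pow (c : R⟦X⟧) {n : ℕ} (hn : n ≠ 0) :
    IsUnit (1 - c * (X : R⟦X⟧) ^ n) :=
  isUnit_one_sub ((dvd_pow_self X hn).mul_left c)

theorem isUnit_qPoch {z : R⟦X⟧} (hz : X ∣ z) (q : R⟦X⟧) (n : ℕ) : IsUnit (qPoch z q n) := by
  unfold qPoch
  rw [IsUnit.prod_iff]
  exact fun j _ => isUnit_one_sub (hz.mul_right _)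

theorem qPoch_succ {A : Type*} [CommRing A] (z q : A) (n : ℕ) :
    qPoch z q (n + 1) = qPoch z q n * (1 - z * q ^ n) := Finset.prod_range_succ _ _

theorem qPoch_succ' {A : Type*} [CommRing A] (z q : A) (n : ℕ) :
    qPoch z q (n + 1) = (1 - z) * qPoch (z * q) q n := by
  unfold qPoch
  rw [Finset.prod_range_succ', pow_zero, mul_one, mul_comm]
  congr 1
  exact Finset.prod_congr rfl fun j _ => by ring

theorem qPoch_add {A : Type*} [CommRing A] (z q : A) (m n : ℕ) :
    qPoch z q (m + n) = qPoch z q m * qPoch (z * q ^ m) q n := by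
  unfold qPoch
  rw [Finset.prod_range_add]
  congr 1
  exact Finset.prod_congr rfl fun j _ => by ring

theorem inverse_eq_mul_inverse_mul {A : Type*} [CommRing A] {u v : A} (hv : IsUnit v) :
    Ring.inverse u = v * Ring.inverse (u * v) := by
  rw [Ring.mul_inverse_rev, ← mul_assoc, Ring.mul_inverse_cancel _ hv, one_mul]

variable (R) in
/-- `1 / (q²; q²)ₙ`. -/
noncomputable def qFactorialInv (n : ℕ) : R⟦X⟧ := Ring.inverse (qPoch (X ^ 2) (X ^ 2) n)

theorem qFactorialInv_zero : qFactorialInv R 0 = 1 := by simp [qFactorialInv, qPoch]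

theorem qFactorialInv_succ (n : ℕ) :
    qFactorialInv R n = (1 - (X ^ 2) ^ (n + 1)) * qFactorialInv R (n + 1) := by
  unfold qFactorialInv
  rw [qPoch_succ, pow_succ' _ n]
  refine inverse_eq_mul_inverse_mul ?_
  rw [← pow_mul]
  exact isUnit_one_sub ((dvd_pow_self X two_ne_zero).mul_right _)

/-- A homogeneous form of the finite `q`-binomial theorem. -/
theorem sum_antidiagonal_qBinomial (N : ℕ) (z w : R⟦X⟧) :
    ∑ p ∈ Finset.HasAntidiagonal.antidiagonal N, (-1) ^ p.1 * (X ^ 2) ^ p.1.choose 2 * z ^ p.1 * w ^ p.2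
        * (qFactorialInv R p.1 * qFactorialInv R p.2) =
      (∏ i ∈ Finset.range N, (w - z * (X ^ 2) ^ i)) * qFactorialInv R N := by
  induction N generalizing z with
  | zero => simp [qFactorialInv_zero]
  | succ N ih =>
    have hu : IsUnit (1 - (X ^ 2 : R⟦X⟧) ^ (N + 1)) := by
      rw [← pow_mul]
      exact isUnit_one_sub (dvd_pow_self X (by omega))
    apply hu.mul_left_cancel
    -- The q-Pascal rule: for p.1 + p.2 = N + 1, 1 - Q^(N+1) = (1 - Q^p.1) + Q^p.1 (1 - Q^p.2) with
    -- Q = X². The two parts give -z and w times the sum for N with z replaced by zQ.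
    have hsplit : ∀ p ∈ Finset.HasAntidiagonal.antidiagonal (N + 1),
        (1 - (X ^ 2 : R⟦X⟧) ^ (N + 1)) * ((-1) ^ p.1 * (X ^ 2) ^ p.1.choose 2 * z ^ p.1 * w ^ p.2
          * (qFactorialInv R p.1 * qFactorialInv R p.2)) =
        (-1) ^ p.1 * (X ^ 2) ^ p.1.choose 2 * z ^ p.1 * w ^ p.2
          * ((1 - (X ^ 2) ^ p.1) * qFactorialInv R p.1 * qFactorialInv R p.2)
        + (-1) ^ p.1 * (X ^ 2) ^ p.1.choose 2 * z ^ p.1 * w ^ p.2 * (X ^ 2) ^ p.1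
          * (qFactorialInv R p.1 * ((1 - (X ^ 2) ^ p.2) * qFactorialInv R p.2)) := by
      intro p hp
      rw [← Finset.HasAntidiagonal.mem_antidiagonal.mp hp]
      ring
    rw [Finset.mul_sum, Finset.sum_congr rfl hsplit, Finset.sum_add_distrib,
      Finset.Nat.sum_antidiagonal_succ, Finset.Nat.sum_antidiagonal_succ']
    simp only [pow_zero, sub_self, zero_mul, mul_zero, zero_add,
      ← qFactorialInv_succ]
    rw [Finset.prod_range_succ', pow_zero, mul_one]
    have h1 : ∏ i ∈ Finset.range N, (w - z * (X ^ 2) ^ (i + 1)) =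
        ∏ i ∈ Finset.range N, (w - z * X ^ 2 * (X ^ 2) ^ i) :=
      Finset.prod_congr rfl fun i _ => by ring
    have h2 := ih (z * X ^ 2)
    rw [h1, mul_comm (1 - (X ^ 2 : R⟦X⟧) ^ (N + 1)), mul_assoc, mul_comm (qFactorialInv R (N + 1)),
      ← qFactorialInv_succ, mul_right_comm, ← h2, ← Finset.sum_add_distrib, Finset.sum_mul]
    refine Finset.sum_congr rfl fun p _ => ?_
    rw [show (p.1 + 1).choose 2 = p.1 + p.1.choose 2 by
      rw [Nat.choose_succ_succ', Nat.choose_one_right]]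
    ring

/-- Orthogonality in the unit Bailey pair: the q-binomial theorem for N = 2t + 1 at a zero of its
product, with its 2t + 2 terms folded about the middle. -/
theorem sum_alternating_qFactorialInv {t : ℕ} (ht : t ≠ 0) :
    ∑ m ∈ Finset.range (t + 1), (-1) ^ m * (X ^ 2) ^ m.choose 2 * (1 - (X ^ 2) ^ (2 * m + 1))
      * (qFactorialInv R (t - m) * qFactorialInv R (t + m + 1)) = 0 := by
  have h := sum_antidiagonal_qBinomial (R := R) (2 * t + 1) 1 ((X ^ 2) ^ (t + 1))
  -- With z = 1 and w = Q^(t+1) the factor i = t + 1 vanishes; it occurs among i < 2t + 1 precisely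
  -- because t ≥ 1. The terms of index t - m and t + 1 + m are then paired.
  rw [Finset.prod_eq_zero (i := t + 1) (Finset.mem_range.mpr (by omega)) (by ring), zero_mul,
    Finset.Nat.sum_antidiagonal_eq_sum_range_succ_mk,
    show (2 * t + 1).succ = (t + 1) + (t + 1) by omega, Finset.sum_range_add,
    ← Finset.sum_range_reflect, ← Finset.sum_add_distrib] at h
  -- Each pair is a summand of the claim times the sign (-1)^(t+1) and a power of Q independent of
  -- m; both are cancelled at the end. Below, t = m + d.
  have key : ∑ m ∈ Finset.range (t + 1),
      (X ^ 2 : R⟦X⟧) ^ ((t + 1).choose 2 + t * (t + 1)) * ((-1) ^ (t + 1) * ((-1) ^ m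
        * (X ^ 2) ^ m.choose 2 * (1 - (X ^ 2) ^ (2 * m + 1))
        * (qFactorialInv R (t - m) * qFactorialInv R (t + m + 1)))) = 0 := by
    rw [← h]
    refine Finset.sum_congr rfl fun m hm => ?_
    obtain ⟨d, rfl⟩ := Nat.exists_eq_add_of_le (Finset.mem_range_succ_iff.mp hm)
    have e1 : (m + d + 1 + m).choose 2 + (m + d + 1) * d =
        m.choose 2 + ((m + d + 1).choose 2 + (m + d) * (m + d + 1)) := by
      have : (((m + d + 1 + m).choose 2 + (m + d + 1) * d : ℕ) : ℚ) =
        ((m.choose 2 + ((m + d + 1).choose 2 + (m + d) * (m + d + 1)) : ℕ) : ℚ) := by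
        push_cast [Nat.cast_choose_two]
        ring
      exact_mod_cast this
    have e2 : d.choose 2 + (m + d + 1) * (m + d + m + 1) =
        m.choose 2 + (2 * m + 1) + ((m + d + 1).choose 2 + (m + d) * (m + d + 1)) := by
      have : ((d.choose 2 + (m + d + 1) * (m + d + m + 1) : ℕ) : ℚ) =
        ((m.choose 2 + (2 * m + 1) + ((m + d + 1).choose 2 + (m + d) * (m + d + 1)) : ℕ) : ℚ) := by
        push_cast [Nat.cast_choose_two]
        ring
      exact_mod_cast this
    simp only [show m + d + 1 - 1 - m = d by omega, show m + d - m = d by omega,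
      show 2 * (m + d) + 1 - d = m + d + m + 1 by omega,
      show 2 * (m + d) + 1 - (m + d + 1 + m) = d by omega, one_pow, mul_one]
    have s1 : (-1 : R⟦X⟧) ^ d = - ((-1) ^ (m + d + 1) * (-1) ^ m) := by
      rw [← pow_add, show m + d + 1 + m = d + (2 * m + 1) by ring, pow_add _ d, pow_succ, pow_mul]
      simp
    have s2 : (-1 : R⟦X⟧) ^ (m + d + 1 + m) = (-1) ^ (m + d + 1) * (-1) ^ m := pow_add _ _ _
    rw [s1, s2]
    generalize hX : (X ^ 2 : R⟦X⟧) = Q at *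
    have g1 : Q ^ (m + d + 1 + m).choose 2 * (Q ^ (m + d + 1)) ^ d =
        Q ^ m.choose 2 * Q ^ ((m + d + 1).choose 2 + (m + d) * (m + d + 1)) := by
      rw [← pow_mul, ← pow_add, e1, pow_add]
    have g2 : Q ^ d.choose 2 * (Q ^ (m + d + 1)) ^ (m + d + m + 1) =
        Q ^ m.choose 2 * Q ^ (2 * m + 1)
          * Q ^ ((m + d + 1).choose 2 + (m + d) * (m + d + 1)) := by
      rw [← pow_mul, ← pow_add, e2, pow_add, pow_add]
    rw [show m + d + 1 + m = m + d + m + 1 by ring] at *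
    linear_combination (-1 : R⟦X⟧) ^ (m + d + 1) * (-1) ^ m * (qFactorialInv R d * qFactorialInv R (m + d + m + 1)) * (g2 - g1)
  rw [← Finset.mul_sum, ← Finset.mul_sum, ← pow_mul] at key
  apply ((isUnit_one.neg (α := R⟦X⟧)).pow (t + 1)).mul_left_cancel
  apply X_pow_mul_cancel (k := 2 * ((t + 1).choose 2 + t * (t + 1)))
  rw [key, mul_zero, mul_zero]


end BaileyPair

end OddDurfee

namespace OddDurfee

open PowerSeries

/-! ### Iterating the Bailey pair over the subscripts -/

section BaileyChain

variable {R : Type*} [CommRing R]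

/-- `(1 - y q^(2j+1)) (1 - q^(2j+1) / y)`. -/
noncomputable def rowFactor (y : Rˣ) (j : ℕ) : R⟦X⟧ :=
  (1 - C (y : R) * X ^ (2 * j + 1)) * (1 - C (↑y⁻¹ : R) * X ^ (2 * j + 1))

theorem isUnit_rowFactor (y : Rˣ) (j : ℕ) : IsUnit (rowFactor y j) :=
  (isUnit_one_sub_mul_X_pow _ (by omega)).mul (isUnit_one_sub_mul_X_pow _ (by omega))

/-- `1 / ((1 - y q^(2j+1)) (1 - q^(2j+1) / y))`. -/
noncomputable def rowFactorInv (y : Rˣ) (j : ℕ) : R⟦X⟧ := Ring.inverse (rowFactor y j)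

theorem rowFactor_mul_inv (y : Rˣ) (j : ℕ) : rowFactor y j * rowFactorInv y j = 1 :=
  Ring.mul_inverse_cancel _ (isUnit_rowFactor y j)

/-- With v = q^(2m+1) and u = q^(2(m+e)+1), the terms in y + 1/y cancel and v(1 + u²) - u(1 + v²) =
v(1 - u/v)(1 - uv). -/
theorem rowFactor_interpolation (y : Rˣ) (m e : ℕ) :
    X ^ (2 * m + 1) * rowFactor y (m + e) =
      X ^ (2 * m + 1) * ((1 - (X ^ 2) ^ e) * (1 - (X ^ 2) ^ (2 * m + e + 1)))
        + X ^ (2 * (m + e) + 1) * rowFactor y m := by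
  have hy : (C (y : R) : R⟦X⟧) * C (↑y⁻¹ : R) = 1 := by
    rw [← map_mul, Units.mul_inv, map_one]
  unfold rowFactor
  simp only [← pow_mul]
  linear_combination X ^ (2 * m + 1) * X ^ (2 * (m + e) + 1)
    * (X ^ (2 * (m + e) + 1) - X ^ (2 * m + 1)) * hy

/-- Summing out one step of the Bailey chain. -/
theorem sum_rowFactorInv (y : Rˣ) (m d : ℕ) :
    ∑ i ∈ Finset.range (d + 1), X ^ (2 * (m + i) + 1)
        * (qFactorialInv R i * qFactorialInv R (2 * m + i + 1))
        * ∏ j ∈ Finset.Ico (m + i) (m + d + 1), rowFactorInv y j =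
      X ^ (2 * m + 1) * rowFactorInv y m
        * (qFactorialInv R d * qFactorialInv R (2 * m + d + 1)) := by
  induction d with
  | zero => simp; ring
  | succ d ih =>
    have h1 : ∀ i ∈ Finset.range (d + 1), (X : R⟦X⟧) ^ (2 * (m + i) + 1)
        * (qFactorialInv R i * qFactorialInv R (2 * m + i + 1))
        * ∏ j ∈ Finset.Ico (m + i) (m + (d + 1) + 1), rowFactorInv y j =
        X ^ (2 * (m + i) + 1) * (qFactorialInv R i * qFactorialInv R (2 * m + i + 1))
          * (∏ j ∈ Finset.Ico (m + i) (m + d + 1), rowFactorInv y j)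
          * rowFactorInv y (m + d + 1) := fun i hi => by
      have := Finset.mem_range.mp hi
      rw [← add_assoc m d 1, Finset.prod_Ico_succ_top (by omega)]
      ring
    rw [Finset.sum_range_succ, Finset.sum_congr rfl h1, ← Finset.sum_mul, ih,
      ← add_assoc m d 1, Finset.prod_Ico_succ_top (by omega), Finset.Ico_self, Finset.prod_empty,
      one_mul, qFactorialInv_succ d, qFactorialInv_succ (2 * m + d + 1)]
    -- Passing to d + 1 gives every old term one more `rowFactorInv` and adds one new term; the
    -- interpolation identity at e = d + 1 combines the two.
    have h2 := rowFactor_interpolation y m (d + 1)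
    have h3 := rowFactor_mul_inv y m
    have h4 := rowFactor_mul_inv y (m + d + 1)
    rw [show 2 * m + (d + 1) + 1 = 2 * m + d + 1 + 1 by ring, ← add_assoc m d 1] at h2
    linear_combination
      (-rowFactorInv y m * rowFactorInv y (m + d + 1)
        * (qFactorialInv R (d + 1) * qFactorialInv R (2 * m + d + 1 + 1))) * h2
      - X ^ (2 * (m + d + 1) + 1) * rowFactorInv y (m + d + 1)
        * (qFactorialInv R (d + 1) * qFactorialInv R (2 * m + d + 1 + 1)) * h3
      + X ^ (2 * m + 1) * rowFactorInv y m
        * (qFactorialInv R (d + 1) * qFactorialInv R (2 * m + d + 1 + 1)) * h4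

/-- The generating function of the two rows, weighted by `q` to the power of the parts marking
the ends of the colour ranges, for largest admissible part `2t + 1`. -/
noncomputable def rowSeries (x : ℕ → Rˣ) : ℕ → ℕ → R⟦X⟧
  | 0, t => if t = 0 then 1 else 0
  | k + 1, t => X ^ (2 * t + 1) * ∑ s ∈ Finset.range (t + 1),
      rowSeries x k s * ∏ j ∈ Finset.Ico s (t + 1), rowFactorInv (x (k + 1)) j

/-- The partner of `rowSeries` in the Bailey pair. -/
noncomputable def rowAlpha (x : ℕ → Rˣ) (k m : ℕ) : R⟦X⟧ :=
  (-1) ^ m * (X ^ 2) ^ m.choose 2 * (1 - (X ^ 2) ^ (2 * m + 1)) * X ^ (k * (2 * m + 1))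
    * ∏ c ∈ Finset.range k, rowFactorInv (x (c + 1)) m

theorem rowAlpha_succ (x : ℕ → Rˣ) (k m : ℕ) :
    rowAlpha x (k + 1) m = rowAlpha x k m * (X ^ (2 * m + 1) * rowFactorInv (x (k + 1)) m) := by
  unfold rowAlpha
  rw [Finset.prod_range_succ]
  ring

/-- The Bailey pair relation, by induction on the number of subscripts. The extra X on the left
avoids dividing q^(2t+1) by q, and in the induction it supplies the factor q^(2s+1) needed for
`sum_rowFactorInv`. -/
theorem X_mul_rowSeries (x : ℕ → Rˣ) (k t : ℕ) :
    X * rowSeries x k t = X ^ (2 * t + 1) * ∑ m ∈ Finset.range (t + 1),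
      rowAlpha x k m * (qFactorialInv R (t - m) * qFactorialInv R (t + m + 1)) := by
  induction k generalizing t with
  | zero =>
    simp only [rowSeries, rowAlpha, zero_mul, pow_zero, mul_one, Finset.range_zero,
      Finset.prod_empty]
    rcases eq_or_ne t 0 with rfl | ht
    · have := qFactorialInv_succ (R := R) 0
      rw [qFactorialInv_zero, zero_add, pow_one] at this
      simp only [zero_add, Finset.range_one, Finset.sum_singleton, mul_zero, pow_one, if_true]
      rw [qFactorialInv_zero, one_mul]
      rw [Nat.choose_zero_succ]
      linear_combination X * this
    · rw [if_neg ht, sum_alternating_qFactorialInv ht, mul_zero, mul_zero]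
  | succ k ih =>
    have h1 : ∀ s ∈ Finset.range (t + 1), X * (rowSeries x k s
        * ∏ j ∈ Finset.Ico s (t + 1), rowFactorInv (x (k + 1)) j) =
        ∑ m ∈ Finset.range (s + 1), rowAlpha x k m * (X ^ (2 * s + 1)
          * (qFactorialInv R (s - m) * qFactorialInv R (s + m + 1))
          * ∏ j ∈ Finset.Ico s (t + 1), rowFactorInv (x (k + 1)) j) := fun s _ => by
      rw [← mul_assoc, ih, Finset.mul_sum, Finset.sum_mul]
      exact Finset.sum_congr rfl fun m _ => by ring
    rw [rowSeries, mul_left_comm, Finset.mul_sum, Finset.sum_congr rfl h1]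
    congr 1
    rw [Finset.sum_comm' (t' := Finset.range (t + 1)) (s' := fun m => Finset.Ico m (t + 1))
      (by intro a b; simp only [Finset.mem_range, Finset.mem_Ico]; omega)]
    refine Finset.sum_congr rfl fun m hm => ?_
    obtain ⟨d, rfl⟩ := Nat.exists_eq_add_of_le (Finset.mem_range_succ_iff.mp hm)
    rw [← Finset.mul_sum, rowAlpha_succ, mul_assoc (rowAlpha x k m)]
    congr 1
    rw [show m + d - m = d by omega, show m + d + m + 1 = 2 * m + d + 1 by ring,
      ← sum_rowFactorInv, Finset.sum_Ico_eq_sum_range, show m + d + 1 - m = d + 1 by omega]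
    refine Finset.sum_congr rfl fun i _ => ?_
    rw [show m + i - m = i by omega, show m + i + m + 1 = 2 * m + i + 1 by ring]

end BaileyChain

end OddDurfee

namespace OddDurfee

open PowerSeries Filter

/-! ### The q-Gauss sum -/

section QGauss

set_option linter.unusedSectionVars false

variable {R : Type*} [CommRing R]

/-- The `i`-th term of a homogeneous form of the `₂φ₁` series of the `q`-Gauss sum, with base
`q²`. -/
noncomputable def gaussTerm (a b c d : R⟦X⟧) (i : ℕ) : R⟦X⟧ :=
  (X ^ 2) ^ i * ((∏ j ∈ Finset.range i, (a + c * (X ^ 2) ^ j))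
      * ∏ j ∈ Finset.range i, (b + d * (X ^ 2) ^ j))
    * (qFactorialInv R i * Ring.inverse (qPoch (c * d * X ^ 2) (X ^ 2) i))

theorem gaussTerm_comm (a b c d : R⟦X⟧) (i : ℕ) : gaussTerm a b c d i = gaussTerm b a d c i := by
  rw [gaussTerm, gaussTerm, mul_comm c d, mul_comm (∏ j ∈ Finset.range i, (a + c * (X ^ 2) ^ j))]

theorem X_pow_dvd_gaussTerm (a b c d : R⟦X⟧) (i : ℕ) : X ^ i ∣ gaussTerm a b c d i := by
  unfold gaussTerm
  rw [← pow_mul, mul_assoc]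
  exact (pow_dvd_pow X (by omega)).mul_right _

theorem gaussTerm_zero (a b c d : R⟦X⟧) : gaussTerm a b c d 0 = 1 := by
  simp [gaussTerm, qFactorialInv_zero, qPoch]

/-- Telescoping form of the contiguous relation `(1 - cdq²) F(c) = (1 + bcq²) F(cq²)`. -/
theorem sum_range_gaussTerm_sub (a b c d : R⟦X⟧) (n : ℕ) :
    ∑ i ∈ Finset.range (n + 1), ((1 - c * d * X ^ 2) * gaussTerm a b c d i
        - (1 + b * c * X ^ 2) * gaussTerm a b (c * X ^ 2) d i) =
      -c * (X ^ 2) ^ (n + 1) * ((∏ j ∈ Finset.range n, (a + c * X ^ 2 * (X ^ 2) ^ j))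
        * ∏ j ∈ Finset.range (n + 1), (b + d * (X ^ 2) ^ j))
        * (qFactorialInv R n * Ring.inverse (qPoch (c * X ^ 2 * d * X ^ 2) (X ^ 2) n)) := by
  induction n with
  | zero =>
    simp [gaussTerm_zero, qFactorialInv_zero, qPoch]
    ring
  | succ n ih =>
    rw [Finset.sum_range_succ, ih]
    unfold gaussTerm
    -- Both denominators are expressed through (cdq⁴; q²)_{n+1}, which leaves a polynomial identity.
    have hE : Ring.inverse (qPoch (c * X ^ 2 * d * X ^ 2) (X ^ 2) n) =
        (1 - c * X ^ 2 * d * X ^ 2 * (X ^ 2) ^ n)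
          * Ring.inverse (qPoch (c * X ^ 2 * d * X ^ 2) (X ^ 2) (n + 1)) := by
      rw [qPoch_succ]
      refine inverse_eq_mul_inverse_mul (isUnit_one_sub ?_)
      exact ((dvd_pow_self X two_ne_zero).mul_left _).mul_right _
    have hE' : (1 - c * d * X ^ 2) * Ring.inverse (qPoch (c * d * X ^ 2) (X ^ 2) (n + 1)) =
        Ring.inverse (qPoch (c * X ^ 2 * d * X ^ 2) (X ^ 2) n) := by
      rw [qPoch_succ', mul_comm (1 - c * d * X ^ 2) (qPoch _ _ _), ← inverse_eq_mul_inverse_mul,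
        show c * d * X ^ 2 * X ^ 2 = c * X ^ 2 * d * X ^ 2 by ring]
      exact isUnit_one_sub ((dvd_pow_self X two_ne_zero).mul_left _)
    have hp : ∏ j ∈ Finset.range (n + 1), (a + c * (X ^ 2) ^ j) =
        (a + c) * ∏ j ∈ Finset.range n, (a + c * X ^ 2 * (X ^ 2) ^ j) := by
      rw [Finset.prod_range_succ', pow_zero, mul_one, mul_comm]
      congr 1
      exact Finset.prod_congr rfl fun j _ => by ring
    rw [hp, Finset.prod_range_succ _ (n + 1),
      Finset.prod_range_succ (fun j => a + c * X ^ 2 * (X ^ 2) ^ j) n,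
      qFactorialInv_succ n, hE]
    rw [hE] at hE'
    generalize Ring.inverse (qPoch (c * X ^ 2 * d * X ^ 2) (X ^ 2) (n + 1)) = E at *
    generalize Ring.inverse (qPoch (c * d * X ^ 2) (X ^ 2) (n + 1)) = E' at *
    generalize ∏ j ∈ Finset.range n, (a + c * X ^ 2 * (X ^ 2) ^ j) = P at *
    generalize ∏ j ∈ Finset.range (n + 1), (b + d * (X ^ 2) ^ j) = P' at *
    generalize qFactorialInv R (n + 1) = D at *
    linear_combination (X ^ 2) ^ (n + 1) * (a + c) * P * P' * D * hE'

theorem locallyFinite_gaussTerm (a b c d : R⟦X⟧) : LocallyFiniteFamily (gaussTerm a b c d) :=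
  locallyFiniteFamily_of_forall_dvd (X_pow_dvd_gaussTerm a b c d)

variable [TopologicalSpace R] [DiscreteTopology R]

/-- The left hand side of the `q`-Gauss sum. -/
noncomputable def gaussSeries (a b c d : R⟦X⟧) : R⟦X⟧ := ∑' i, gaussTerm a b c d i

theorem gaussSeries_comm (a b c d : R⟦X⟧) : gaussSeries a b c d = gaussSeries b a d c :=
  tsum_congr (gaussTerm_comm a b c d)

theorem hasSum_gaussTerm (a b c d : R⟦X⟧) :
    HasSum (gaussTerm a b c d) (gaussSeries a b c d) :=
  (locallyFinite_gaussTerm a b c d).summable.hasSum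

/-- The telescoped partial sums carry the factor q^(2(n+1)), so they tend to 0. -/
theorem gaussSeries_contiguous (a b c d : R⟦X⟧) :
    (1 - c * d * X ^ 2) * gaussSeries a b c d =
      (1 + b * c * X ^ 2) * gaussSeries a b (c * X ^ 2) d := by
  have h := ((hasSum_gaussTerm a b c d).mul_left (1 - c * d * X ^ 2)).sub
    ((hasSum_gaussTerm a b (c * X ^ 2) d).mul_left (1 + b * c * X ^ 2))
  have h1 := (h.tendsto_sum_nat).comp (tendsto_add_atTop_nat 1)
  rw [← sub_eq_zero]
  refine tendsto_nhds_unique h1 (tendsto_of_X_pow_dvd_sub fun n => ?_)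
  rw [Function.comp_apply, sum_range_gaussTerm_sub, sub_zero, ← pow_mul]
  exact (((pow_dvd_pow X (by omega)).mul_left _).mul_right _).mul_right _

theorem gaussSeries_iterate (a b c d : R⟦X⟧) (n : ℕ) :
    qPoch (c * d * X ^ 2) (X ^ 2) n * gaussSeries a b c d =
      qPoch (-b * c * X ^ 2) (X ^ 2) n * gaussSeries a b (c * (X ^ 2) ^ n) d := by
  induction n with
  | zero => simp [qPoch]
  | succ n ih =>
    have h := gaussSeries_contiguous a b (c * (X ^ 2) ^ n) d
    rw [qPoch_succ, qPoch_succ, mul_right_comm, ih, pow_succ (X ^ 2) n, ← mul_assoc c]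
    linear_combination qPoch (-b * c * X ^ 2) (X ^ 2) n * h

/-- Continuity of the series in c at 0, proved term by term modulo X^n; there the two denominators
agree, hence so do their inverses. -/
theorem X_pow_dvd_gaussSeries_sub (a b c d : R⟦X⟧) (n : ℕ) (hc : X ^ n ∣ c) :
    X ^ n ∣ gaussSeries a b c d - gaussSeries a b 0 d := by
  refine X_pow_dvd_of_hasSum ((hasSum_gaussTerm a b c d).sub (hasSum_gaussTerm a b 0 d))
    fun i => ?_
  let φ := Ideal.Quotient.mk (Ideal.span {(X : R⟦X⟧) ^ n})
  rw [← Ideal.mem_span_singleton, ← Ideal.Quotient.eq_zero_iff_mem, map_sub, sub_eq_zero]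
  have hφ : φ c = φ 0 := by
    rw [map_zero]
    exact Ideal.Quotient.eq_zero_iff_mem.mpr (Ideal.mem_span_singleton.mpr hc)
  have hinv : φ (Ring.inverse (qPoch (c * d * X ^ 2) (X ^ 2) i)) =
      φ (Ring.inverse (qPoch (0 * d * X ^ 2) (X ^ 2) i)) := by
    have hX : ∀ z : R⟦X⟧, X ∣ z * d * X ^ 2 := fun z =>
      (dvd_pow_self X two_ne_zero).mul_left _
    have h1 := congrArg φ (Ring.mul_inverse_cancel _ (isUnit_qPoch (hX c) (X ^ 2) i))
    have h2 := congrArg φ (Ring.mul_inverse_cancel _ (isUnit_qPoch (hX 0) (X ^ 2) i))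
    have h3 : φ (qPoch (c * d * X ^ 2) (X ^ 2) i) = φ (qPoch (0 * d * X ^ 2) (X ^ 2) i) := by
      simp only [qPoch, map_prod, map_sub, map_mul, hφ]
    rw [map_mul, map_one] at h1 h2
    rw [h3] at h1
    linear_combination φ (Ring.inverse (qPoch (0 * d * X ^ 2) (X ^ 2) i)) * h1
      - φ (Ring.inverse (qPoch (c * d * X ^ 2) (X ^ 2) i)) * h2
  change φ _ = φ _
  simp only [gaussTerm, map_mul, map_prod, map_add, hφ] at hinv ⊢
  rw [hinv]

theorem tendsto_qPoch {z : R⟦X⟧} :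
    Tendsto (fun n => qPoch z (X ^ 2) n) atTop (nhds (qPochInf z (X ^ 2))) :=
  (multipliable_qPochInf z (X ^ 2) (by simp)).hasProd.tendsto_prod_nat

theorem qPochInf_zero : qPochInf (0 : R⟦X⟧) (X ^ 2) = 1 := by simp [qPochInf]

theorem qPochInf_eq_qPoch_mul (z : R⟦X⟧) (n : ℕ) :
    qPochInf z (X ^ 2) = qPoch z (X ^ 2) n * qPochInf (z * (X ^ 2) ^ n) (X ^ 2) := by
  have h1 := (tendsto_qPoch (z := z)).comp (tendsto_add_atTop_nat n)
  refine tendsto_nhds_unique h1 ?_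
  have h2 := (tendsto_qPoch (z := z * (X ^ 2) ^ n)).const_mul (qPoch z (X ^ 2) n)
  refine h2.congr fun m => ?_
  rw [Function.comp_apply, add_comm m n, qPoch_add]

theorem isUnit_qPochInf {z : R⟦X⟧} (hz : X ∣ z) : IsUnit (qPochInf z (X ^ 2)) := by
  rw [isUnit_iff_constantCoeff]
  have h1 := (WithPiTopology.continuous_constantCoeff (R := R)).continuousAt.tendsto.comp
    (tendsto_qPoch (z := z))
  have h2 : (constantCoeff (R := R)) ∘ (fun n => qPoch z (X ^ 2) n) = fun _ => 1 := by
    funext n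
    simp [qPoch, map_prod, X_dvd_iff.mp hz]
  rw [h2] at h1
  rw [tendsto_nhds_unique h1 tendsto_const_nhds]
  exact isUnit_one

/-- Iterating c ↦ cq² drives c to 0. -/
theorem gaussSeries_limit (a b c d : R⟦X⟧) :
    qPochInf (c * d * X ^ 2) (X ^ 2) * gaussSeries a b c d =
      qPochInf (-b * c * X ^ 2) (X ^ 2) * gaussSeries a b 0 d := by
  refine tendsto_nhds_unique ((tendsto_qPoch (z := c * d * X ^ 2)).mul_const (gaussSeries a b c d))
    ?_
  simp only [gaussSeries_iterate]
  refine tendsto_qPoch.mul (tendsto_of_X_pow_dvd_sub fun n => ?_)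
  apply X_pow_dvd_gaussSeries_sub
  rw [← pow_mul]
  exact (pow_dvd_pow X (by omega)).mul_left _

/-- The symmetry exchanging (a, c) with (b, d) lets the same limit remove d as well. -/
theorem gaussSeries_zero (a b c d : R⟦X⟧) :
    qPochInf (c * d * X ^ 2) (X ^ 2) * gaussSeries a b c d =
      qPochInf (-b * c * X ^ 2) (X ^ 2) * qPochInf (-a * d * X ^ 2) (X ^ 2)
        * gaussSeries a b 0 0 := by
  have h := gaussSeries_limit b a d 0
  rw [mul_zero, zero_mul, qPochInf_zero, one_mul, gaussSeries_comm, gaussSeries_comm b a 0 0] at h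
  rw [gaussSeries_limit, h, ← mul_assoc]

theorem qPochInf_mul_gaussSeries_zero_zero (a b : R⟦X⟧) :
    qPochInf (a * b * X ^ 2) (X ^ 2) * gaussSeries a b 0 0 = 1 := by
  -- At d = -b the factor j = 0 of the second product vanishes, so only the term i = 0 survives.
  -- This evaluates the remaining constant.
  have h := gaussSeries_zero a b 0 (-b)
  rw [mul_zero, zero_mul, zero_mul, qPochInf_zero, one_mul, one_mul, neg_mul_neg] at h
  rw [← h, gaussSeries, tsum_eq_single 0, gaussTerm_zero]
  intro i hi
  have : ∏ j ∈ Finset.range i, (b + -b * (X ^ 2) ^ j) = 0 :=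
    Finset.prod_eq_zero (Finset.mem_range.mpr (Nat.pos_of_ne_zero hi)) (by ring)
  rw [gaussTerm, this, mul_zero, mul_zero, zero_mul]

/-- The `q`-Gauss sum. -/
theorem qGauss (a b c d : R⟦X⟧) :
    qPochInf (c * d * X ^ 2) (X ^ 2) * qPochInf (a * b * X ^ 2) (X ^ 2) * gaussSeries a b c d =
      qPochInf (-a * d * X ^ 2) (X ^ 2) * qPochInf (-b * c * X ^ 2) (X ^ 2) := by
  linear_combination qPochInf (a * b * X ^ 2) (X ^ 2) * gaussSeries_zero a b c d
    + qPochInf (-a * d * X ^ 2) (X ^ 2) * qPochInf (-b * c * X ^ 2) (X ^ 2)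
      * qPochInf_mul_gaussSeries_zero_zero a b

end QGauss

end OddDurfee

namespace OddDurfee

open PowerSeries Filter

/-! ### Bailey's lemma: from the Bailey pair to the right-hand side -/

section BaileyLemma

variable {R : Type*} [CommRing R]

/-- `∏_{j < t} (a + q^(2j+1))`, the generating function of the partitions into distinct odd parts
of size at most `2t - 1` in which `a` counts the missing parts. -/
noncomputable def sideSeries (a : R⟦X⟧) (t : ℕ) : R⟦X⟧ :=
  ∏ j ∈ Finset.range t, (a + X ^ (2 * j + 1))

theorem sideSeries_add (a : R⟦X⟧) (n i : ℕ) :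
    sideSeries a (n + i) =
      sideSeries a n * ∏ j ∈ Finset.range i, (a + X ^ (2 * n + 1) * (X ^ 2) ^ j) := by
  unfold sideSeries
  rw [Finset.prod_range_add]
  congr 1
  exact Finset.prod_congr rfl fun j _ => by ring

theorem sideSeries_eq_qPoch (a : (R⟦X⟧)ˣ) (n : ℕ) :
    sideSeries (a : R⟦X⟧) n = (a : R⟦X⟧) ^ n * qPoch (-X * (↑a⁻¹ : R⟦X⟧)) (X ^ 2) n := by
  unfold sideSeries qPoch
  rw [← Finset.card_range n, ← Finset.prod_const, Finset.card_range, ← Finset.prod_mul_distrib]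
  refine Finset.prod_congr rfl fun j _ => ?_
  linear_combination -(X ^ 2) ^ j * X * a.mul_inv

theorem ringInverse_eq_of_mul_eq_one {A : Type*} [CommRing A] {u v : A} (h : u * v = 1) :
    Ring.inverse u = v := by
  have hu : IsUnit u := IsUnit.of_mul_eq_one v h
  apply hu.mul_left_cancel
  rw [Ring.mul_inverse_cancel _ hu, h]

theorem qFactorialInv_add (m i : ℕ) :
    qFactorialInv R (m + i) =
      qFactorialInv R m * Ring.inverse (qPoch (X ^ 2 * (X ^ 2) ^ m) (X ^ 2) i) := by
  rw [qFactorialInv, qPoch_add, Ring.mul_inverse_rev, mul_comm, qFactorialInv]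

/-- `rowAlpha x (k + 1) m` divided by `q`. -/
noncomputable def rowAlphaDivX (x : ℕ → Rˣ) (k m : ℕ) : R⟦X⟧ :=
  (-1) ^ m * (X ^ 2) ^ m.choose 2 * (1 - (X ^ 2) ^ (2 * m + 1)) * X ^ (k * (2 * m + 1) + 2 * m)
    * ∏ c ∈ Finset.range (k + 1), rowFactorInv (x (c + 1)) m

theorem rowSeries_succ_eq (x : ℕ → Rˣ) (k t : ℕ) :
    rowSeries x (k + 1) t = X ^ (2 * t + 1) * ∑ m ∈ Finset.range (t + 1),
      rowAlphaDivX x k m * (qFactorialInv R (t - m) * qFactorialInv R (t + m + 1)) := by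
  apply X_mul_cancel
  rw [X_mul_rowSeries, mul_left_comm]
  congr 1
  rw [Finset.mul_sum]
  refine Finset.sum_congr rfl fun m _ => ?_
  rw [rowAlpha, rowAlphaDivX]
  ring

/-- The contribution of the `n`-th term of the Bailey pair to the total generating function at
`t = n + i`. -/
noncomputable def baileyTerm (x : ℕ → Rˣ) (k : ℕ) (a b : R⟦X⟧) (p : ℕ × ℕ) : R⟦X⟧ :=
  sideSeries a (p.1 + p.2) * sideSeries b (p.1 + p.2) * X ^ (2 * (p.1 + p.2) + 1)
    * (rowAlphaDivX x k p.1 * (qFactorialInv R p.2 * qFactorialInv R (2 * p.1 + 1 + p.2)))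

/-- The factors of `sideSeries` beyond the n-th start at a + q^(2n+1), and (q²;q²)_{2n+1+i} leaves
(q^(4n+4);q²)_i. This is the q-Gauss summand with c = d = q^(2n+1). -/
theorem baileyTerm_eq (x : ℕ → Rˣ) (k : ℕ) (a b : R⟦X⟧) (n i : ℕ) :
    baileyTerm x k a b (n, i) =
      sideSeries a n * sideSeries b n * X ^ (2 * n + 1) * rowAlphaDivX x k n
        * qFactorialInv R (2 * n + 1) * gaussTerm a b (X ^ (2 * n + 1)) (X ^ (2 * n + 1)) i := by
  rw [baileyTerm, sideSeries_add, sideSeries_add, qFactorialInv_add, gaussTerm,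
    show (X ^ 2 : R⟦X⟧) * (X ^ 2) ^ (2 * n + 1) = X ^ (2 * n + 1) * X ^ (2 * n + 1) * X ^ 2 by ring]
  ring

theorem locallyFinite_baileyTerm (x : ℕ → Rˣ) (k : ℕ) (a b : R⟦X⟧) :
    LocallyFiniteFamily (baileyTerm x k a b) := by
  intro N
  refine ((Set.finite_lt_nat N).prod (Set.finite_lt_nat N)).subset ?_
  rintro ⟨n, i⟩ h
  have h1 : 2 * (n + i) + 1 < N := by
    by_contra hlt
    exact h (((pow_dvd_pow X (not_lt.mp hlt)).mul_left _).mul_right _)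
  exact ⟨show n < N by omega, show i < N by omega⟩

theorem sum_antidiagonal_baileyTerm (x : ℕ → Rˣ) (k : ℕ) (a b : R⟦X⟧) (t : ℕ) :
    ∑ p ∈ Finset.HasAntidiagonal.antidiagonal t, baileyTerm x k a b p =
      sideSeries a t * sideSeries b t * rowSeries x (k + 1) t := by
  rw [rowSeries_succ_eq, Finset.Nat.sum_antidiagonal_eq_sum_range_succ_mk, ← mul_assoc,
    Finset.mul_sum]
  refine Finset.sum_congr rfl fun m hm => ?_
  have := Finset.mem_range_succ_iff.mp hm
  rw [baileyTerm, show m + (t - m) = t by omega, show 2 * m + 1 + (t - m) = t + m + 1 by omega]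

theorem X_pow_dvd_markedDurfeeTerm {k : ℕ} (a b : (R⟦X⟧)ˣ) (x : Fin k → (R⟦X⟧)ˣ) (n : ℕ) :
    (X : R⟦X⟧) ^ n ∣ markedDurfeeTerm a b x X n :=
  ((pow_dvd_pow X (by nlinarith)).mul_left _).mul_right _

variable [TopologicalSpace R] [DiscreteTopology R]

theorem hasSum_baileyTerm (x : ℕ → Rˣ) (k : ℕ) (a b : R⟦X⟧) (n : ℕ) :
    HasSum (fun i => baileyTerm x k a b (n, i))
      (sideSeries a n * sideSeries b n * X ^ (2 * n + 1) * rowAlphaDivX x k n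
        * qFactorialInv R (2 * n + 1)
        * gaussSeries a b (X ^ (2 * n + 1)) (X ^ (2 * n + 1))) := by
  rw [funext (baileyTerm_eq x k a b n)]
  exact (hasSum_gaussTerm a b (X ^ (2 * n + 1)) (X ^ (2 * n + 1))).mul_left
    (sideSeries a n * sideSeries b n * X ^ (2 * n + 1) * rowAlphaDivX x k n
        * qFactorialInv R (2 * n + 1))

/-- The infinite products from q-Gauss are tails: (-aq;q²)_∞ and (-bq;q²)_∞ lose their first n + 1
factors, and (q²;q²)_∞ its first 2n + 1. The lost factors are the finite denominators on the two
sides. -/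
theorem markedDurfeePrefactor_mul_term (k : ℕ) (a b : Rˣ) (x : Fin (k + 1) → Rˣ) (y : ℕ → Rˣ)
    (hy : ∀ i : Fin (k + 1), y (i + 1) = x i) (n : ℕ) :
    markedDurfeePrefactor (constUnit a : R⟦X⟧) (constUnit b) X *
        markedDurfeeTerm (constUnit a) (constUnit b) (fun i => constUnit (x i)) X n =
      sideSeries (constUnit a : R⟦X⟧) n * sideSeries (constUnit b : R⟦X⟧) n * X ^ (2 * n + 1)
        * rowAlphaDivX y k n * qFactorialInv R (2 * n + 1)
        * gaussSeries (constUnit a : R⟦X⟧) (constUnit b) (X ^ (2 * n + 1)) (X ^ (2 * n + 1)) := by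
  have hprod : Ring.inverse (∏ i : Fin (k + 1),
      ((1 - (constUnit (x i) : R⟦X⟧) * X ^ (2 * n + 1))
        * (1 - X ^ (2 * n + 1) * (↑(constUnit (x i))⁻¹ : R⟦X⟧)))) =
      ∏ c ∈ Finset.range (k + 1), rowFactorInv (y (c + 1)) n := by
    apply ringInverse_eq_of_mul_eq_one
    rw [Finset.prod_range, ← Finset.prod_mul_distrib]
    refine Finset.prod_eq_one fun i _ => ?_
    have h := rowFactor_mul_inv (x i) n
    rw [rowFactor, mul_comm (C (↑(x i)⁻¹ : R))] at h
    rw [hy]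
    exact h
  have hQ : IsUnit (qPochInf (X ^ 2 : R⟦X⟧) (X ^ 2)) :=
    isUnit_qPochInf (dvd_pow_self X two_ne_zero)
  have hab : IsUnit (qPochInf ((constUnit a : R⟦X⟧) * (constUnit b : R⟦X⟧) * X ^ 2) (X ^ 2)) :=
    isUnit_qPochInf ((dvd_pow_self X two_ne_zero).mul_left _)
  have hX : ∀ c : R⟦X⟧, IsUnit (qPoch (-c * X) (X ^ 2) (n + 1)) := fun c =>
    isUnit_qPoch (dvd_mul_left _ _) _ _
  have hsplit : ∀ c : R⟦X⟧, qPochInf (-c * X) (X ^ 2) =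
      qPoch (-c * X) (X ^ 2) (n + 1) * qPochInf (-c * X ^ (2 * n + 1) * X ^ 2) (X ^ 2) := fun c => by
    rw [qPochInf_eq_qPoch_mul _ (n + 1)]
    congr 2
    ring
  have hsplitQ : qPochInf (X ^ 2 : R⟦X⟧) (X ^ 2) = qPoch (X ^ 2) (X ^ 2) (2 * n + 1)
      * qPochInf (X ^ (2 * n + 1) * X ^ (2 * n + 1) * X ^ 2) (X ^ 2) := by
    rw [qPochInf_eq_qPoch_mul _ (2 * n + 1)]
    congr 2
    ring
  have hD : qPoch (X ^ 2 : R⟦X⟧) (X ^ 2) (2 * n + 1) * qFactorialInv R (2 * n + 1) = 1 :=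
    Ring.mul_inverse_cancel _ (isUnit_qPoch (dvd_pow_self X two_ne_zero) _ _)
  have hG := qGauss (constUnit a : R⟦X⟧) (constUnit b) (X ^ (2 * n + 1)) (X ^ (2 * n + 1))
  have hexp : (X : R⟦X⟧) ^ (n ^ 2 + (2 * (k + 1) + 1) * n + (k + 1)) =
      (X ^ 2) ^ n.choose 2 * X ^ (k * (2 * n + 1) + 2 * n) * X ^ (2 * n + 1) := by
    rw [← pow_mul, ← pow_add, ← pow_add]
    congr 1
    have : ((n ^ 2 + (2 * (k + 1) + 1) * n + (k + 1) : ℕ) : ℚ) =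
        ((2 * n.choose 2 + (k * (2 * n + 1) + 2 * n) + (2 * n + 1) : ℕ) : ℚ) := by
      push_cast [Nat.cast_choose_two]
      ring
    exact_mod_cast this
  rw [markedDurfeePrefactor, markedDurfeeTerm, sideSeries_eq_qPoch, sideSeries_eq_qPoch,
    rowAlphaDivX, hexp, Ring.mul_inverse_rev _ (∏ i, _), hprod]
  set A := (constUnit a : R⟦X⟧)
  set B := (constUnit b : R⟦X⟧)
  have h1 := Ring.mul_inverse_cancel _ (hQ.mul hab)
  have h2 := Ring.mul_inverse_cancel _ ((hX A).mul (hX B))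
  -- All denominators are units and are cleared; `hcore` below is q-Gauss with (q²;q²)_∞ completed.
  apply (hQ.mul hab).mul_left_cancel
  apply ((hX A).mul (hX B)).mul_left_cancel
  have hcore : qPochInf (X ^ 2 : R⟦X⟧) (X ^ 2) * qPochInf (A * B * X ^ 2) (X ^ 2)
      * qFactorialInv R (2 * n + 1) * gaussSeries A B (X ^ (2 * n + 1)) (X ^ (2 * n + 1)) =
      qPochInf (-A * X ^ (2 * n + 1) * X ^ 2) (X ^ 2)
        * qPochInf (-B * X ^ (2 * n + 1) * X ^ 2) (X ^ 2) := by
    rw [hsplitQ]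
    linear_combination (qPoch (X ^ 2 : R⟦X⟧) (X ^ 2) (2 * n + 1) * qFactorialInv R (2 * n + 1)) * hG
      + (qPochInf (-A * X ^ (2 * n + 1) * X ^ 2) (X ^ 2)
        * qPochInf (-B * X ^ (2 * n + 1) * X ^ 2) (X ^ 2)) * hD
  rw [hsplit A, hsplit B]
  generalize Ring.inverse (qPochInf (X ^ 2 : R⟦X⟧) (X ^ 2) * qPochInf (A * B * X ^ 2) (X ^ 2)) = I1
    at *
  generalize Ring.inverse (qPoch (-A * X) (X ^ 2 : R⟦X⟧) (n + 1) * qPoch (-B * X) (X ^ 2) (n + 1))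
    = I2 at *
  set pa := qPoch (-X * (↑(constUnit a)⁻¹ : R⟦X⟧)) (X ^ 2) n
  set pb := qPoch (-X * (↑(constUnit b)⁻¹ : R⟦X⟧)) (X ^ 2) n
  generalize ∏ c ∈ Finset.range (k + 1), rowFactorInv (y (c + 1)) n = H at *
  generalize qPochInf (-A * X ^ (2 * n + 1) * X ^ 2) (X ^ 2) = HA at *
  generalize qPochInf (-B * X ^ (2 * n + 1) * X ^ 2) (X ^ 2) = HB at *
  generalize qPochInf (X ^ 2 : R⟦X⟧) (X ^ 2) = U at *
  generalize qPochInf (A * B * X ^ 2) (X ^ 2) = V at *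
  generalize gaussSeries A B (X ^ (2 * n + 1)) (X ^ (2 * n + 1)) = G at *
  generalize qFactorialInv R (2 * n + 1) = D at *
  generalize qPoch (-A * X) (X ^ 2) (n + 1) = PA at *
  generalize qPoch (-B * X) (X ^ 2) (n + 1) = PB at *
  generalize (X ^ 2 : R⟦X⟧) ^ n.choose 2 = e1 at *
  generalize (X : R⟦X⟧) ^ (k * (2 * n + 1) + 2 * n) = e2 at *
  rw [neg_pow, mul_pow, show (X ^ 2 : R⟦X⟧) ^ (2 * n + 1) = X ^ (4 * n + 2) by ring]
  linear_combination ((1 - X ^ (4 * n + 2)) * pa * pb * (-1) ^ n * A ^ n * B ^ n * e1 * e2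
    * X ^ (2 * n + 1) * H) * (PA * PB * HA * HB * (PA * PB * I2 * h1 + h2) - PA * PB * hcore)

/-- Bailey's lemma for the Bailey pair `(rowAlpha, rowSeries)`. -/
theorem exists_hasSum_markedDurfeeTerm (k : ℕ) (a b : Rˣ) (x : Fin (k + 1) → Rˣ) (y : ℕ → Rˣ)
    (hy : ∀ i : Fin (k + 1), y (i + 1) = x i) :
    ∃ S : R⟦X⟧,
      HasSum (markedDurfeeTerm (constUnit a) (constUnit b) (fun i => constUnit (x i)) X) S ∧
      HasSum (fun t => sideSeries (constUnit a : R⟦X⟧) t * sideSeries (constUnit b : R⟦X⟧) t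
          * rowSeries y (k + 1) t)
        (markedDurfeePrefactor (constUnit a : R⟦X⟧) (constUnit b) X * S) := by
  have hS : HasSum (markedDurfeeTerm (constUnit a : (R⟦X⟧)ˣ) (constUnit b)
      (fun i => constUnit (x i)) X) _ :=
    (locallyFiniteFamily_of_forall_dvd (X_pow_dvd_markedDurfeeTerm _ _ _)).summable.hasSum
  refine ⟨_, hS, ?_⟩
  have h1 := hS.mul_left (markedDurfeePrefactor (constUnit a : R⟦X⟧) (constUnit b) X)
  have h2 := (locallyFinite_baileyTerm y k (constUnit a : R⟦X⟧) (constUnit b)).summable.hasSum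
  have h3 := h2.prod_fiberwise (g := fun n => markedDurfeePrefactor (constUnit a : R⟦X⟧)
      (constUnit b) X * markedDurfeeTerm (constUnit a) (constUnit b)
        (fun i => constUnit (x i)) X n) fun n => by
    rw [markedDurfeePrefactor_mul_term k a b x y hy]
    exact hasSum_baileyTerm y k _ _ n
  rw [h1.unique h3]
  -- The same double family, summed above over i for fixed n, is now summed over the antidiagonals n
  -- + i = t.
  have h4 := (Finset.HasAntidiagonal.sigmaAntidiagonalEquivProd (A := ℕ)).hasSum_iff.mpr h2
  have h5 := h4.sigma fun t => hasSum_fintype _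
  convert h5 using 1
  funext t
  rw [← sum_antidiagonal_baileyTerm, ← Finset.sum_coe_sort]
  rfl

end BaileyLemma

end OddDurfee

namespace OddDurfee

open PowerSeries

/-! ### Chains of largest parts -/

section Chains

/-- `n 0 = 0 ≤ n 1 ≤ ⋯ ≤ n k = t`, extended by the constant value `t`; the parts with subscript
`c` of a symbol range over `[2 n (c - 1) + 1, 2 n c + 1]`. -/
structure IsColorChain (k t : ℕ) (n : ℕ → ℕ) : Prop where
  zero : n 0 = 0
  mono : Monotone n
  top : ∀ i, k ≤ i → n i = t

theorem IsColorChain.le {k t : ℕ} {n : ℕ → ℕ} (h : IsColorChain k t n) (i : ℕ) : n i ≤ t := by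
  rw [← h.top (max i k) (le_max_right _ _)]
  exact h.mono (le_max_left _ _)

/-- Extend a chain by one step. -/
def extendChain (k t : ℕ) (n : ℕ → ℕ) (i : ℕ) : ℕ := if i ≤ k then n i else t

theorem IsColorChain.extend {k s t : ℕ} {n : ℕ → ℕ} (h : IsColorChain k s n) (hst : s ≤ t) :
    IsColorChain (k + 1) t (extendChain k t n) where
  zero := by simp [extendChain, h.zero]
  mono i j hij := by
    unfold extendChain
    split_ifs
    · exact h.mono hij
    · exact (h.le i).trans hst
    · omega
    · exact le_rfl
  top i hi := by
    unfold extendChain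
    rw [if_neg (by omega)]

/-- A chain of length k + 1 is its value s at k together with its truncation there. Constancy beyond
the last step is what makes the truncation unique. -/
theorem extendChain_bijective (k t : ℕ) : Function.Bijective
    (fun p : (Σ s : Fin (t + 1), {n // IsColorChain k s n}) =>
      (⟨extendChain k t p.2.1, p.2.2.extend (Nat.lt_succ_iff.mp p.1.2)⟩ :
        {n // IsColorChain (k + 1) t n})) := by
  constructor
  · rintro ⟨s, n, hn⟩ ⟨s', n', hn'⟩ h
    have h1 : ∀ i ≤ k, n i = n' i := fun i hi => by
      simpa [extendChain, hi] using congrFun (congrArg Subtype.val h) i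
    obtain rfl : s = s' := by
      ext
      rw [← hn.top k le_rfl, ← hn'.top k le_rfl, h1 k le_rfl]
    congr
    funext i
    rcases le_total i k with hi | hi
    · exact h1 i hi
    · rw [hn.top i hi, hn'.top i hi]
  · rintro ⟨n, hn⟩
    refine ⟨⟨⟨n k, Nat.lt_succ_iff.mpr (hn.le k)⟩, fun i => n (min i k), ?_, ?_, ?_⟩, ?_⟩
    · simp [hn.zero]
    · exact fun i j hij => hn.mono (min_le_min_right k hij)
    · exact fun i hi => by rw [min_eq_right hi]
    · apply Subtype.ext
      funext i
      change extendChain k t (fun i => n (min i k)) i = n i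
      unfold extendChain
      split_ifs with hi
      · exact congrArg n (min_eq_left hi)
      · rw [hn.top i (by omega)]

theorem finite_colorChain (k t : ℕ) : Finite {n // IsColorChain k t n} := by
  induction k generalizing t with
  | zero =>
    have : Subsingleton {n // IsColorChain 0 t n} :=
      ⟨fun a b => Subtype.ext (funext fun i => by
        rw [a.2.top i (Nat.zero_le i), b.2.top i (Nat.zero_le i)])⟩
    exact Finite.of_subsingleton
  | succ k ih =>
    have := ih
    exact Finite.of_surjective _ (extendChain_bijective k t).2

variable {R : Type*} [CommRing R]

/-- The contribution of a fixed chain to `rowSeries`. -/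
noncomputable def chainSeries (x : ℕ → Rˣ) (k : ℕ) (n : ℕ → ℕ) : R⟦X⟧ :=
  ∏ c ∈ Finset.range k, (X ^ (2 * n (c + 1) + 1)
    * ∏ j ∈ Finset.Ico (n c) (n (c + 1) + 1), rowFactorInv (x (c + 1)) j)

theorem chainSeries_extend (x : ℕ → Rˣ) {k s : ℕ} (t : ℕ) {n : ℕ → ℕ} (h : IsColorChain k s n) :
    chainSeries x (k + 1) (extendChain k t n) = X ^ (2 * t + 1) * (chainSeries x k n
      * ∏ j ∈ Finset.Ico s (t + 1), rowFactorInv (x (k + 1)) j) := by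
  unfold chainSeries
  rw [Finset.prod_range_succ]
  have h1 : ∏ c ∈ Finset.range k, ((X : R⟦X⟧) ^ (2 * extendChain k t n (c + 1) + 1)
      * ∏ j ∈ Finset.Ico (extendChain k t n c) (extendChain k t n (c + 1) + 1),
        rowFactorInv (x (c + 1)) j) = ∏ c ∈ Finset.range k, (X ^ (2 * n (c + 1) + 1)
    * ∏ j ∈ Finset.Ico (n c) (n (c + 1) + 1), rowFactorInv (x (c + 1)) j) :=
    Finset.prod_congr rfl fun c hc => by
      have := Finset.mem_range.mp hc
      simp only [extendChain, if_pos this.le, if_pos (Nat.succ_le_iff.mpr this)]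
  have h2 : extendChain k t n k = s := by simp [extendChain, h.top k le_rfl]
  have h3 : extendChain k t n (k + 1) = t := by simp [extendChain]
  rw [h1, h2, h3]
  ring

variable [TopologicalSpace R] [DiscreteTopology R]

theorem locallyFiniteSum_chainSeries (x : ℕ → Rˣ) (k t : ℕ) :
    LocallyFiniteSum (fun n : {n // IsColorChain k t n} => chainSeries x k n.1)
      (rowSeries x k t) := by
  induction k generalizing t with
  | zero =>
    rcases eq_or_ne t 0 with rfl | ht
    · have h0 : IsColorChain 0 0 fun _ => 0 := ⟨rfl, fun _ _ _ => le_rfl, fun _ _ => rfl⟩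
      let _ : Unique {n // IsColorChain 0 0 n} :=
        { default := ⟨_, h0⟩
          uniq := fun a => Subtype.ext (funext fun i => a.2.top i (Nat.zero_le i)) }
      have := LocallyFiniteSum.of_fintype
        (fun n : {n // IsColorChain 0 0 n} => chainSeries x 0 n.1)
      rw [Fintype.sum_unique] at this
      simpa [chainSeries, rowSeries] using this
    · have : IsEmpty {n // IsColorChain 0 t n} :=
        ⟨fun a => ht (by rw [← a.2.top 0 le_rfl, a.2.zero])⟩
      let _ : Fintype {n // IsColorChain 0 t n} := Fintype.ofIsEmpty
      have := LocallyFiniteSum.of_fintype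
        (fun n : {n // IsColorChain 0 t n} => chainSeries x 0 n.1)
      simpa [rowSeries, ht] using this
  | succ k ih =>
    rw [rowSeries, Finset.sum_range]
    have h := LocallyFiniteSum.sigma
      (f := fun p : (Σ s : Fin (t + 1), {n // IsColorChain k s n}) =>
        X ^ (2 * t + 1) * (chainSeries x k p.2.1
          * ∏ j ∈ Finset.Ico (p.1 : ℕ) (t + 1), rowFactorInv (x (k + 1)) j))
      (g := fun s : Fin (t + 1) => X ^ (2 * t + 1) * (rowSeries x k s
          * ∏ j ∈ Finset.Ico (s : ℕ) (t + 1), rowFactorInv (x (k + 1)) j))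
      (fun s => by
        simp only [mul_comm (chainSeries x k _), mul_comm (rowSeries x k s)]
        exact ((ih s).const_mul _).const_mul _)
      (fun N => Set.toFinite _) (hasSum_fintype _)
    rw [← Finset.mul_sum] at h
    have h2 := h.equiv (Equiv.ofBijective _ (extendChain_bijective k t)).symm
    convert h2 using 1
    funext n
    obtain ⟨p, rfl⟩ := (Equiv.ofBijective _ (extendChain_bijective k t)).surjective n
    rw [Function.comp_apply, Equiv.symm_apply_apply]
    exact chainSeries_extend x t p.2.2

end Chains

/-! ### Entries admitted by a chain -/

section Cells

/-- The pairs (part, subscript) admitted by a chain. -/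
def cells (k : ℕ) (n : ℕ → ℕ) : Finset (ℕ × ℕ) :=
  ((Finset.range k).sigma fun c => Finset.Ico (n c) (n (c + 1) + 1)).image
    fun p => (2 * p.2 + 1, p.1 + 1)

theorem mem_cells {k : ℕ} {n : ℕ → ℕ} {e : ℕ × ℕ} :
    e ∈ cells k n ↔ ∃ c j, c < k ∧ n c ≤ j ∧ j ≤ n (c + 1) ∧ e = (2 * j + 1, c + 1) := by
  simp only [cells, Finset.mem_image, Finset.mem_sigma, Finset.mem_range, Finset.mem_Ico,
    Sigma.exists, Nat.lt_succ_iff]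
  constructor
  · rintro ⟨c, j, ⟨h1, h2, h3⟩, rfl⟩
    exact ⟨c, j, h1, h2, h3, rfl⟩
  · rintro ⟨c, j, h1, h2, h3, rfl⟩
    exact ⟨c, j, ⟨h1, h2, h3⟩, rfl⟩

theorem prod_cells {M : Type*} [CommMonoid M] (k : ℕ) (n : ℕ → ℕ) (f : ℕ × ℕ → M) :
    ∏ e ∈ cells k n, f e = ∏ c ∈ Finset.range k, ∏ j ∈ Finset.Ico (n c) (n (c + 1) + 1),
      f (2 * j + 1, c + 1) := by
  rw [cells, Finset.prod_image, Finset.prod_sigma]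
  rintro ⟨c, j⟩ _ ⟨c', j'⟩ _ h
  simp only [Prod.mk.injEq] at h
  obtain rfl : c = c' := by omega
  obtain rfl : j = j' := by omega
  rfl

/-- The largest parts of the top row with subscripts `1, …, k - 1`. -/
def marks (k : ℕ) (n : ℕ → ℕ) : Multiset (ℕ × ℕ) :=
  (Multiset.range (k - 1)).map fun c => (2 * n (c + 1) + 1, c + 1)

theorem mem_marks {k : ℕ} {n : ℕ → ℕ} {e : ℕ × ℕ} :
    e ∈ marks k n ↔ ∃ c, c + 1 < k ∧ e = (2 * n (c + 1) + 1, c + 1) := by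
  simp only [marks, Multiset.mem_map, Multiset.mem_range]
  constructor
  · rintro ⟨c, hc, rfl⟩
    exact ⟨c, by omega, rfl⟩
  · rintro ⟨c, hc, rfl⟩
    exact ⟨c, by omega, rfl⟩

theorem nodup_marks (k : ℕ) (n : ℕ → ℕ) : (marks k n).Nodup := by
  refine (Multiset.nodup_range _).map fun c c' h => ?_
  simpa using congrArg Prod.snd h

theorem marks_subset_cells {k t : ℕ} {n : ℕ → ℕ} (h : IsColorChain k t n) {e : ℕ × ℕ}
    (he : e ∈ marks k n) : e ∈ cells k n := by
  obtain ⟨c, hc, rfl⟩ := mem_marks.mp he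
  exact mem_cells.mpr ⟨c, n (c + 1), by omega, h.mono (Nat.le_succ c), le_rfl, rfl⟩

/-- The ranges of different subscripts are ordered and can share only a common endpoint. This is why
a row can be recovered from its multiset of entries. -/
theorem cells_comparable {k t : ℕ} {n : ℕ → ℕ} (h : IsColorChain k t n) {e f : ℕ × ℕ}
    (he : e ∈ cells k n) (hf : f ∈ cells k n) (hef : e.2 < f.2) : e.1 ≤ f.1 := by
  obtain ⟨c, j, h1, h2, h3, rfl⟩ := mem_cells.mp he
  obtain ⟨c', j', h1', h2', h3', rfl⟩ := mem_cells.mp hf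
  have : n (c + 1) ≤ n c' := h.mono (by simpa using hef)
  dsimp only
  omega

end Cells

/-! ### The generating function of the symbol data -/

section Series

variable {R : Type*} [CommRing R]

/-- The weight of an entry of a row. -/
noncomputable def entryWeight (y : ℕ → Rˣ) (e : ℕ × ℕ) : R⟦X⟧ := C (y e.2 : R) * X ^ e.1

theorem X_dvd_entryWeight (y : ℕ → Rˣ) {k : ℕ} {n : ℕ → ℕ} {e : ℕ × ℕ} (he : e ∈ cells k n) :
    X ∣ entryWeight y e := by
  obtain ⟨c, j, -, -, -, rfl⟩ := mem_cells.mp he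
  exact (dvd_pow_self X (by simp)).mul_left _

theorem prod_cells_inverse (y : ℕ → Rˣ) (k : ℕ) (n : ℕ → ℕ) :
    (∏ e ∈ cells k n, Ring.inverse (1 - entryWeight y e))
        * ∏ e ∈ cells k n, Ring.inverse (1 - entryWeight (fun c => (y c)⁻¹) e) =
      ∏ c ∈ Finset.range k, ∏ j ∈ Finset.Ico (n c) (n (c + 1) + 1), rowFactorInv (y (c + 1)) j := by
  rw [← Finset.prod_mul_distrib, prod_cells]
  refine Finset.prod_congr rfl fun c _ => Finset.prod_congr rfl fun j _ => ?_
  rw [rowFactorInv, rowFactor, Ring.mul_inverse_rev, mul_comm]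
  rfl

/-- The possible parts of the first two subscripts of a symbol. -/
def oddsBelow (t : ℕ) : Finset ℕ := (Finset.range t).image fun j => 2 * j + 1

theorem mem_oddsBelow {t p : ℕ} : p ∈ oddsBelow t ↔ Odd p ∧ p < 2 * t := by
  simp only [oddsBelow, Finset.mem_image, Finset.mem_range]
  constructor
  · rintro ⟨j, hj, rfl⟩
    exact ⟨⟨j, rfl⟩, by omega⟩
  · rintro ⟨⟨j, rfl⟩, hj⟩
    exact ⟨j, by omega, rfl⟩

theorem card_oddsBelow_sdiff (t : ℕ) (ν : Finset ℕ) :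
    (oddsBelow t \ ν).card = MarkedOddDurfeeSymbol.missing t ν := by
  unfold MarkedOddDurfeeSymbol.missing
  symm
  refine Finset.card_bij (fun x _ => 2 * x - 1) ?_ ?_ ?_
  · intro x hx
    obtain ⟨h1, h2⟩ := Finset.mem_filter.mp hx
    obtain ⟨h3, h4⟩ := Finset.mem_Icc.mp h1
    exact Finset.mem_sdiff.mpr ⟨mem_oddsBelow.mpr ⟨⟨x - 1, by omega⟩, by omega⟩, h2⟩
  · intro x hx x' hx' h
    have h1 := (Finset.mem_Icc.mp (Finset.mem_filter.mp hx).1).1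
    have h2 := (Finset.mem_Icc.mp (Finset.mem_filter.mp hx').1).1
    omega
  · intro p hp
    obtain ⟨h1, h2⟩ := Finset.mem_sdiff.mp hp
    obtain ⟨⟨j, rfl⟩, h4⟩ := mem_oddsBelow.mp h1
    exact ⟨j + 1, Finset.mem_filter.mpr ⟨Finset.mem_Icc.mpr ⟨by omega, by omega⟩, h2⟩, by omega⟩

/-- The weight of a partition into distinct odd parts of size at most `2t - 1`. -/
noncomputable def sideWeight (a : R⟦X⟧) (t : ℕ) (ν : Finset ℕ) : R⟦X⟧ :=
  a ^ MarkedOddDurfeeSymbol.missing t ν * X ^ ∑ p ∈ ν, p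

/-- In the expansion of ∏ (q^p + a), choosing a at p means that p is missing. -/
theorem sum_sideWeight (a : R⟦X⟧) (t : ℕ) :
    ∑ ν ∈ (oddsBelow t).powerset, sideWeight a t ν = sideSeries a t := by
  have h : sideSeries a t = ∏ p ∈ oddsBelow t, (X ^ p + a) := by
    rw [oddsBelow, Finset.prod_image fun i _ j _ h => by simpa using h]
    exact Finset.prod_congr rfl fun j _ => add_comm _ _
  rw [h, Finset.prod_add]
  refine Finset.sum_congr rfl fun ν _ => ?_
  rw [Finset.prod_pow_eq_pow_sum, Finset.prod_const, card_oddsBelow_sdiff, sideWeight, mul_comm]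

/-- The data that determine a `k`-marked generalized odd Durfee symbol: its third subscript, the
chain of the largest parts of each subscript in the top row, the remaining entries of the top row,
the entries of the bottom row, and its first two subscripts. -/
abbrev SymbolData (k : ℕ) : Type :=
  Σ t : ℕ, Σ n : {n // IsColorChain k t n},
    ({m : Multiset (ℕ × ℕ) // ∀ e ∈ m, e ∈ cells k n.1} ×
      {m : Multiset (ℕ × ℕ) // ∀ e ∈ m, e ∈ cells k n.1}) ×
    {ν // ν ∈ (oddsBelow t).powerset} × {ν // ν ∈ (oddsBelow t).powerset}

/-- The weight of the symbol determined by `d`. -/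
noncomputable def dataWeight {k : ℕ} (y : ℕ → Rˣ) (a b : R⟦X⟧) (d : SymbolData k) : R⟦X⟧ :=
  (∏ c ∈ Finset.range k, X ^ (2 * d.2.1.1 (c + 1) + 1)) *
    ((d.2.2.1.1.1.map (entryWeight y)).prod
        * (d.2.2.1.2.1.map (entryWeight fun c => (y c)⁻¹)).prod *
      (sideWeight a d.1 d.2.2.2.1.1 * sideWeight b d.1 d.2.2.2.2.1))

variable [TopologicalSpace R] [DiscreteTopology R]

theorem locallyFiniteSum_sideWeight (a : R⟦X⟧) (t : ℕ) :
    LocallyFiniteSum (fun ν : {ν // ν ∈ (oddsBelow t).powerset} => sideWeight a t ν.1)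
      (sideSeries a t) := by
  rw [← sum_sideWeight, ← Finset.sum_coe_sort]
  exact LocallyFiniteSum.of_fintype _

theorem locallyFiniteSum_dataWeight (y : ℕ → Rˣ) (k : ℕ) (a b : R⟦X⟧) {S : R⟦X⟧}
    (hS : HasSum (fun t => sideSeries a t * sideSeries b t * rowSeries y (k + 1) t) S) :
    LocallyFiniteSum (dataWeight (k := k + 1) y a b) S := by
  refine LocallyFiniteSum.sigma (fun t => ?_) (fun N => ?_) hS
  · refine LocallyFiniteSum.sigma
      (g := fun n => sideSeries a t * sideSeries b t * chainSeries y (k + 1) n.1)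
      (fun n => ?_) (fun N => ?_) ?_
    · have h := (((locallyFiniteSum_multiset (entryWeight y) (cells (k + 1) n.1)
          fun e he => X_dvd_entryWeight y he).mul
        (locallyFiniteSum_multiset (entryWeight fun c => (y c)⁻¹) (cells (k + 1) n.1)
          fun e he => X_dvd_entryWeight _ he)).mul
        ((locallyFiniteSum_sideWeight a t).mul (locallyFiniteSum_sideWeight b t))).const_mul
          (∏ c ∈ Finset.range (k + 1), X ^ (2 * n.1 (c + 1) + 1))
      rw [prod_cells_inverse] at h
      convert h using 1
      · rfl
      · rw [chainSeries, Finset.prod_mul_distrib]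
        ring
    · have := finite_colorChain (k + 1) t
      exact Set.toFinite _
    · exact ((locallyFiniteSum_chainSeries y (k + 1) t).const_mul _).hasSum
  -- The last mark is q^(2t+1), so only t < N can contribute weights not divisible by q^N.
  · refine (Set.finite_lt_nat N).subset ?_
    rintro t ⟨⟨n, m⟩, h⟩
    by_contra hlt
    refine h (Dvd.dvd.mul_right ?_ _)
    refine Dvd.dvd.trans ?_ (Finset.dvd_prod_of_mem _ (Finset.self_mem_range_succ k))
    have := n.2.top (k + 1) le_rfl
    have : ¬ t < N := hlt
    exact pow_dvd_pow X (show N ≤ 2 * n.1 (k + 1) + 1 by omega)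

end Series

end OddDurfee

namespace OddDurfee

open PowerSeries

/-! ### Rows as sorted multisets -/

section Sorting

/-- Arrange the entries of a row by the sum of part and subscript. If any two entries are
comparable, this arranges both the parts and the subscripts in non-increasing order. -/
def sortRow (m : List (ℕ × ℕ)) : List (ℕ × ℕ) :=
  m.insertionSort fun e f => f.1 + f.2 ≤ e.1 + e.2

theorem sortRow_perm (m : List (ℕ × ℕ)) : (sortRow m).Perm m := List.perm_insertionSort _ _

theorem sortRow_pairwise {m : List (ℕ × ℕ)}
    (h : ∀ e ∈ m, ∀ f ∈ m, e.2 < f.2 → e.1 ≤ f.1) :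
    (sortRow m).Pairwise fun e f => f.1 ≤ e.1 ∧ f.2 ≤ e.2 := by
  have : Std.Total fun e f : ℕ × ℕ => f.1 + f.2 ≤ e.1 + e.2 := ⟨fun e f => le_total _ _⟩
  have : IsTrans (ℕ × ℕ) fun e f => f.1 + f.2 ≤ e.1 + e.2 := ⟨fun e f g h1 h2 => h2.trans h1⟩
  have h1 := List.pairwise_insertionSort (fun e f : ℕ × ℕ => f.1 + f.2 ≤ e.1 + e.2) m
  refine List.Pairwise.imp_of_mem ?_ h1
  intro e f he hf hef
  have h2 := h e ((sortRow_perm m).mem_iff.mp he) f ((sortRow_perm m).mem_iff.mp hf)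
  have h3 := h f ((sortRow_perm m).mem_iff.mp hf) e ((sortRow_perm m).mem_iff.mp he)
  omega

theorem fst_le_of_pairwise {l : List (ℕ × ℕ)} (h : l.Pairwise fun e f => f.1 ≤ e.1 ∧ f.2 ≤ e.2)
    {e f : ℕ × ℕ} (he : e ∈ l) (hf : f ∈ l) (hef : e.2 < f.2) : e.1 ≤ f.1 := by
  have : Std.Symm fun e f : ℕ × ℕ => (f.1 ≤ e.1 ∧ f.2 ≤ e.2) ∨ (e.1 ≤ f.1 ∧ e.2 ≤ f.2) :=
    ⟨fun e f h => h.symm⟩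
  have h1 := List.Pairwise.forall_of_forall
    (R := fun e f : ℕ × ℕ => (f.1 ≤ e.1 ∧ f.2 ≤ e.2) ∨ (e.1 ≤ f.1 ∧ e.2 ≤ f.2))
    (fun x _ => .inl ⟨le_rfl, le_rfl⟩) (h.imp fun h => .inl h) he hf
  omega

theorem eq_of_perm_of_pairwise {l l' : List (ℕ × ℕ)} (hl : l.Perm l')
    (h : l.Pairwise fun e f => f.1 ≤ e.1 ∧ f.2 ≤ e.2)
    (h' : l'.Pairwise fun e f => f.1 ≤ e.1 ∧ f.2 ≤ e.2) : l = l' := by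
  refine List.Perm.eq_of_pairwise (fun e f _ _ h1 h2 => ?_) h h' hl
  ext <;> omega

/-- The row with a given multiset of entries. -/
noncomputable def rowOfMultiset (m : Multiset (ℕ × ℕ)) : List (ℕ × ℕ) := sortRow m.toList

theorem coe_rowOfMultiset (m : Multiset (ℕ × ℕ)) : (rowOfMultiset m : Multiset (ℕ × ℕ)) = m :=
  (Multiset.coe_eq_coe.mpr (sortRow_perm _)).trans (Multiset.coe_toList m)

theorem mem_rowOfMultiset {m : Multiset (ℕ × ℕ)} {e : ℕ × ℕ} : e ∈ rowOfMultiset m ↔ e ∈ m := by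
  rw [← Multiset.mem_coe, coe_rowOfMultiset]

theorem rowOfMultiset_pairwise {k t : ℕ} {n : ℕ → ℕ} (h : IsColorChain k t n)
    {m : Multiset (ℕ × ℕ)} (hm : ∀ e ∈ m, e ∈ cells k n) :
    (rowOfMultiset m).Pairwise fun e f => f.1 ≤ e.1 ∧ f.2 ≤ e.2 :=
  sortRow_pairwise fun e he f hf =>
    cells_comparable h (hm e (Multiset.mem_toList.mp he)) (hm f (Multiset.mem_toList.mp hf))

theorem rowOfMultiset_coe {l : List (ℕ × ℕ)}
    (h : l.Pairwise fun e f => f.1 ≤ e.1 ∧ f.2 ≤ e.2) : rowOfMultiset (l : Multiset (ℕ × ℕ)) = l := by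
  have hp : (l : Multiset (ℕ × ℕ)).toList.Perm l := by
    rw [← Multiset.coe_eq_coe, Multiset.coe_toList]
  refine eq_of_perm_of_pairwise ((sortRow_perm _).trans hp) (sortRow_pairwise ?_) h
  intro e he f hf
  exact fst_le_of_pairwise h (hp.mem_iff.mp he) (hp.mem_iff.mp hf)

end Sorting

/-! ### Symbols correspond to chains with free multisets -/

section Bijection

variable {k : ℕ}

theorem mem_top_cells {t : ℕ} {n : ℕ → ℕ} (h : IsColorChain k t n) {m : Multiset (ℕ × ℕ)}
    (hm : ∀ e ∈ m, e ∈ cells k n) : ∀ e ∈ m + marks k n, e ∈ cells k n := fun e he =>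
  (Multiset.mem_add.mp he).elim (hm e) (marks_subset_cells h)

theorem cells_le {t : ℕ} {n : ℕ → ℕ} (h : IsColorChain k t n) {e : ℕ × ℕ} (he : e ∈ cells k n) :
    Odd e.1 ∧ e.1 ≤ 2 * t + 1 ∧ 1 ≤ e.2 ∧ e.2 ≤ k ∧ 2 * n (e.2 - 1) + 1 ≤ e.1
      ∧ e.1 ≤ 2 * n e.2 + 1 := by
  obtain ⟨c, j, h1, h2, h3, rfl⟩ := mem_cells.mp he
  have := h.le (c + 1)
  refine ⟨⟨j, rfl⟩, ?_, ?_, ?_, ?_, ?_⟩ <;> simp <;> omega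

/-- The symbol determined by a chain and the remaining data. -/
noncomputable def symbolOfData (d : SymbolData k) : MarkedOddDurfeeSymbol k where
  t := d.1
  lam := d.2.2.2.1.1
  mu := d.2.2.2.2.1
  top := rowOfMultiset (d.2.2.1.1.1 + marks k d.2.1.1)
  bot := rowOfMultiset d.2.2.1.2.1
  lam_odd p hp := (mem_oddsBelow.mp (Finset.mem_powerset.mp d.2.2.2.1.2 hp)).1
  lam_lt p hp := (mem_oddsBelow.mp (Finset.mem_powerset.mp d.2.2.2.1.2 hp)).2
  mu_odd p hp := (mem_oddsBelow.mp (Finset.mem_powerset.mp d.2.2.2.2.2 hp)).1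
  mu_lt p hp := (mem_oddsBelow.mp (Finset.mem_powerset.mp d.2.2.2.2.2 hp)).2
  top_odd e he := (cells_le d.2.1.2 (mem_top_cells d.2.1.2 d.2.2.1.1.2 e
    (mem_rowOfMultiset.mp he))).1
  top_le e he := (cells_le d.2.1.2 (mem_top_cells d.2.1.2 d.2.2.1.1.2 e
    (mem_rowOfMultiset.mp he))).2.1
  bot_odd e he := (cells_le d.2.1.2 (d.2.2.1.2.2 e (mem_rowOfMultiset.mp he))).1
  bot_le e he := (cells_le d.2.1.2 (d.2.2.1.2.2 e (mem_rowOfMultiset.mp he))).2.1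
  top_color e he :=
    have h := cells_le d.2.1.2 (mem_top_cells d.2.1.2 d.2.2.1.1.2 e (mem_rowOfMultiset.mp he))
    ⟨h.2.2.1, h.2.2.2.1⟩
  bot_color e he :=
    have h := cells_le d.2.1.2 (d.2.2.1.2.2 e (mem_rowOfMultiset.mp he))
    ⟨h.2.2.1, h.2.2.2.1⟩
  top_sorted := rowOfMultiset_pairwise d.2.1.2 (mem_top_cells d.2.1.2 d.2.2.1.1.2)
  bot_sorted := rowOfMultiset_pairwise d.2.1.2 d.2.2.1.2.2
  top_occurs c h1 h2 := by
    refine ⟨_, mem_rowOfMultiset.mpr (Multiset.mem_add.mpr (.inr (mem_marks.mpr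
      ⟨c - 1, by omega, rfl⟩))), ?_⟩
    change c - 1 + 1 = c
    omega
  bot_lower e he f hf hef := by
    have h1 := (cells_le d.2.1.2 (d.2.2.1.2.2 e (mem_rowOfMultiset.mp he))).2.2.2.2.1
    have h2 := (cells_le d.2.1.2 (mem_top_cells d.2.1.2 d.2.2.1.1.2 f
      (mem_rowOfMultiset.mp hf))).2.2.2.2.2
    rw [← hef, Nat.add_sub_cancel] at h1
    exact h2.trans h1
  bot_upper e he hek := by
    have h := cells_le d.2.1.2 (d.2.2.1.2.2 e (mem_rowOfMultiset.mp he))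
    have he2 : e.2 - 1 + 1 = e.2 := by omega
    refine ⟨(2 * d.2.1.1 e.2 + 1, e.2), mem_rowOfMultiset.mpr (Multiset.mem_add.mpr (.inr
      (mem_marks.mpr ⟨e.2 - 1, by omega, by rw [he2]⟩))), rfl, h.2.2.2.2.2⟩

theorem coe_top_symbolOfData (d : SymbolData k) :
    ((symbolOfData d).top : Multiset (ℕ × ℕ)) = d.2.2.1.1.1 + marks k d.2.1.1 :=
  coe_rowOfMultiset _

theorem coe_bot_symbolOfData (d : SymbolData k) :
    ((symbolOfData d).bot : Multiset (ℕ × ℕ)) = d.2.2.1.2.1 :=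
  coe_rowOfMultiset _

/-- The chain can be read off from the top row. -/
theorem chain_le_of_top_eq {t' : ℕ} {n n' : ℕ → ℕ} (h' : IsColorChain k t' n')
    {m m' : Multiset (ℕ × ℕ)} (hm' : ∀ e ∈ m', e ∈ cells k n')
    (h : m + marks k n = m' + marks k n') {c : ℕ} (hc : c + 1 < k) : n (c + 1) ≤ n' (c + 1) := by
  have h1 : (2 * n (c + 1) + 1, c + 1) ∈ m + marks k n :=
    Multiset.mem_add.mpr (.inr (mem_marks.mpr ⟨c, hc, rfl⟩))
  rw [h] at h1
  have h2 := (cells_le h' (mem_top_cells h' hm' _ h1)).2.2.2.2.2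
  dsimp only at h2
  omega

theorem symbolOfData_injective : Function.Injective (symbolOfData (k := k)) := by
  rintro ⟨t, ⟨n, hn⟩, ⟨⟨T, hT⟩, ⟨B, hB⟩⟩, ν⟩ ⟨t', ⟨n', hn'⟩, ⟨⟨T', hT'⟩, ⟨B', hB'⟩⟩, ν'⟩ h
  obtain rfl : t = t' := congrArg MarkedOddDurfeeSymbol.t h
  have htop : T + marks k n = T' + marks k n' := by
    have := congrArg (fun δ => (δ.top : Multiset (ℕ × ℕ))) h
    simpa only [coe_top_symbolOfData] using this
  have hbot : B = B' := by
    have := congrArg (fun δ => (δ.bot : Multiset (ℕ × ℕ))) h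
    simpa only [coe_bot_symbolOfData] using this
  obtain rfl : n = n' := by
    funext i
    rcases Nat.lt_or_ge i k with hi | hi
    · cases i with
      | zero => rw [hn.zero, hn'.zero]
      | succ c =>
        exact (chain_le_of_top_eq hn' hT' htop hi).antisymm
          (chain_le_of_top_eq hn hT htop.symm hi)
    · rw [hn.top i hi, hn'.top i hi]
  obtain rfl : T = T' := add_right_cancel htop
  subst hbot
  obtain ⟨ν1, ν2⟩ := ν
  obtain ⟨ν1', ν2'⟩ := ν'
  obtain rfl : ν1 = ν1' := Subtype.ext (congrArg MarkedOddDurfeeSymbol.lam h)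
  obtain rfl : ν2 = ν2' := Subtype.ext (congrArg MarkedOddDurfeeSymbol.mu h)
  rfl

theorem exists_largest_part (δ : MarkedOddDurfeeSymbol k) {c : ℕ} (h1 : 1 ≤ c) (h2 : c < k) :
    ∃ j, (2 * j + 1, c) ∈ δ.top ∧ ∀ e ∈ δ.top, e.2 = c → e.1 ≤ 2 * j + 1 := by
  obtain ⟨e, he, hec⟩ := δ.top_occurs c h1 h2
  obtain ⟨f, hf, hmax⟩ := Finset.exists_max_image (δ.top.toFinset.filter fun e => e.2 = c) Prod.fst
    ⟨e, Finset.mem_filter.mpr ⟨List.mem_toFinset.mpr he, hec⟩⟩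
  obtain ⟨hf1, hf2⟩ := Finset.mem_filter.mp hf
  rw [List.mem_toFinset] at hf1
  obtain ⟨j, hj⟩ := δ.top_odd f hf1
  refine ⟨j, ?_, fun e he hec => ?_⟩
  · rw [← hj, ← hf2]
    exact hf1
  · rw [← hj]
    exact hmax e (Finset.mem_filter.mpr ⟨List.mem_toFinset.mpr he, hec⟩)

theorem exists_chain (hk : 1 ≤ k) (δ : MarkedOddDurfeeSymbol k) :
    ∃ n, IsColorChain k δ.t n ∧ (∀ e ∈ marks k n, e ∈ δ.top) ∧ (∀ e ∈ δ.top, e ∈ cells k n) ∧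
      ∀ e ∈ δ.bot, e ∈ cells k n := by
  have hex : ∀ c, ∃ j, 1 ≤ c → c < k →
      (2 * j + 1, c) ∈ δ.top ∧ ∀ e ∈ δ.top, e.2 = c → e.1 ≤ 2 * j + 1 := fun c => by
    by_cases h : 1 ≤ c ∧ c < k
    · obtain ⟨j, hj⟩ := exists_largest_part δ h.1 h.2
      exact ⟨j, fun _ _ => hj⟩
    · exact ⟨0, fun h1 h2 => absurd ⟨h1, h2⟩ h⟩
  choose M hM using hex
  let n : ℕ → ℕ := fun i => if i = 0 then 0 else if i < k then M i else δ.t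
  have n0 : n 0 = 0 := rfl
  have nM : ∀ i, 1 ≤ i → i < k → n i = M i := fun i h1 h2 => by
    simp only [n]
    rw [if_neg (by omega), if_pos h2]
  have nt : ∀ i, k ≤ i → n i = δ.t := fun i hi => by
    simp only [n]
    rw [if_neg (by omega), if_neg (by omega)]
  have hle : ∀ i, 1 ≤ i → i < k → n i ≤ δ.t := fun i h1 h2 => by
    have := δ.top_le _ (hM i h1 h2).1
    rw [nM i h1 h2]
    dsimp only at this
    omega
  have hmono : Monotone n := monotone_nat_of_le_succ fun i => by
    rcases Nat.eq_zero_or_pos i with rfl | hi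
    · rw [n0]
      exact Nat.zero_le _
    · rcases Nat.lt_or_ge i k with hik | hik
      · rcases Nat.lt_or_ge (i + 1) k with hik' | hik'
        · have := fst_le_of_pairwise δ.top_sorted (hM i hi hik).1 (hM (i + 1) (by omega) hik').1
            (Nat.lt_succ_self i)
          rw [nM i hi hik, nM (i + 1) (by omega) hik']
          dsimp only at this
          omega
        · rw [nt (i + 1) hik']
          exact hle i hi hik
      · rw [nt i hik, nt (i + 1) (by omega)]
  refine ⟨n, ⟨n0, hmono, nt⟩, ?_, ?_, ?_⟩
  · intro e he
    obtain ⟨c, hc, rfl⟩ := mem_marks.mp he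
    rw [nM (c + 1) (by omega) hc]
    exact (hM (c + 1) (by omega) hc).1
  · intro e he
    obtain ⟨j, hj⟩ := δ.top_odd e he
    obtain ⟨h1, h2⟩ := δ.top_color e he
    refine mem_cells.mpr ⟨e.2 - 1, j, by omega, ?_, ?_, Prod.ext hj (by dsimp only; omega)⟩
    -- For the top row the lower bound comes from sortedness: the mark with the preceding subscript
    -- cannot exceed this entry. For the bottom row it is `bot_lower`.
    · rcases Nat.eq_or_lt_of_le h1 with h | h
      · rw [← h, Nat.sub_self, n0]
        exact Nat.zero_le _
      · have := fst_le_of_pairwise δ.top_sorted (hM (e.2 - 1) (by omega) (by omega)).1 he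
          (by dsimp only; omega)
        rw [nM (e.2 - 1) (by omega) (by omega)]
        dsimp only at this
        omega
    · rw [Nat.sub_add_cancel h1]
      rcases Nat.eq_or_lt_of_le h2 with h | h
      · have := δ.top_le e he
        rw [h, nt k le_rfl]
        omega
      · have := (hM e.2 h1 h).2 e he rfl
        rw [nM e.2 h1 h]
        omega
  · intro e he
    obtain ⟨j, hj⟩ := δ.bot_odd e he
    obtain ⟨h1, h2⟩ := δ.bot_color e he
    refine mem_cells.mpr ⟨e.2 - 1, j, by omega, ?_, ?_, Prod.ext hj (by dsimp only; omega)⟩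
    · rcases Nat.eq_or_lt_of_le h1 with h | h
      · rw [← h, Nat.sub_self, n0]
        exact Nat.zero_le _
      · have := δ.bot_lower e he _ (hM (e.2 - 1) (by omega) (by omega)).1
          (by dsimp only; omega)
        rw [nM (e.2 - 1) (by omega) (by omega)]
        dsimp only at this
        omega
    · rw [Nat.sub_add_cancel h1]
      rcases Nat.eq_or_lt_of_le h2 with h | h
      · have := δ.bot_le e he
        rw [h, nt k le_rfl]
        omega
      · obtain ⟨f, hf, hfe, hle⟩ := δ.bot_upper e he h
        have := (hM e.2 h1 h).2 f hf hfe
        rw [nM e.2 h1 h]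
        omega

theorem symbolOfData_surjective (hk : 1 ≤ k) : Function.Surjective (symbolOfData (k := k)) := by
  intro δ
  obtain ⟨n, hn, hmarks, htop, hbot⟩ := exists_chain hk δ
  -- The marks have distinct subscripts, so membership in the top row suffices for removing them as
  -- a multiset and adding them back.
  have hle : marks k n ≤ (δ.top : Multiset (ℕ × ℕ)) :=
    (Multiset.le_iff_subset (nodup_marks k n)).mpr fun e he => hmarks e he
  refine ⟨⟨δ.t, ⟨n, hn⟩, ⟨⟨(δ.top : Multiset (ℕ × ℕ)) - marks k n, fun e he => htop e
    (Multiset.mem_of_le tsub_le_self he)⟩, ⟨δ.bot, hbot⟩⟩,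
    ⟨δ.lam, Finset.mem_powerset.mpr fun p hp => mem_oddsBelow.mpr
      ⟨δ.lam_odd p hp, δ.lam_lt p hp⟩⟩,
    ⟨δ.mu, Finset.mem_powerset.mpr fun p hp => mem_oddsBelow.mpr
      ⟨δ.mu_odd p hp, δ.mu_lt p hp⟩⟩⟩, ?_⟩
  apply MarkedOddDurfeeSymbol.ext
  · rfl
  · rfl
  · rfl
  · change rowOfMultiset ((δ.top : Multiset (ℕ × ℕ)) - marks k n + marks k n) = δ.top
    rw [tsub_add_cancel_of_le hle, rowOfMultiset_coe δ.top_sorted]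
  · exact rowOfMultiset_coe δ.bot_sorted

end Bijection

end OddDurfee

namespace OddDurfee

open PowerSeries

/-! ### Matching weights and statistics -/

section Weights

variable {R : Type*} [CommRing R]

theorem prod_map_entryWeight {k : ℕ} (x : Fin k → Rˣ) (y : ℕ → Rˣ)
    (hy : ∀ i : Fin k, y (i + 1) = x i) (T : Multiset (ℕ × ℕ))
    (hT : ∀ e ∈ T, 1 ≤ e.2 ∧ e.2 ≤ k) :
    (T.map (entryWeight y)).prod =
      C ((∏ i : Fin k, x i ^ T.countP (fun e => e.2 = (i : ℕ) + 1) : Rˣ) : R)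
        * X ^ (T.map Prod.fst).sum := by
  induction T using Multiset.induction_on with
  | empty => simp
  | cons e T ih =>
    obtain ⟨h1, h2⟩ := hT e (Multiset.mem_cons_self e T)
    rw [Multiset.map_cons, Multiset.prod_cons, Multiset.map_cons, Multiset.sum_cons,
      ih fun f hf => hT f (Multiset.mem_cons_of_mem hf)]
    have h : ∏ i : Fin k, x i ^ (e ::ₘ T).countP (fun e => e.2 = (i : ℕ) + 1) =
        y e.2 * ∏ i : Fin k, x i ^ T.countP (fun e => e.2 = (i : ℕ) + 1) := by
      simp only [Multiset.countP_cons, pow_add, Finset.prod_mul_distrib]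
      rw [mul_comm]
      congr 1
      rw [Finset.prod_eq_single ⟨e.2 - 1, by omega⟩]
      · rw [← hy, if_pos (Nat.sub_add_cancel h1).symm, pow_one, Nat.sub_add_cancel h1]
      · intro i _ hi
        rw [if_neg, pow_zero]
        exact fun h => hi (Fin.ext (by simp only; omega))
      · simp
    rw [h, entryWeight, Units.val_mul, map_mul]
    ring

/-- The summand 2t + 1 of the size is the last term of the sum over the chain, whose final value is
t. -/
theorem size_symbolOfData {k : ℕ} (d : SymbolData (k + 1)) :
    (symbolOfData d).size = (d.2.2.1.1.1.map Prod.fst).sum + (d.2.2.1.2.1.map Prod.fst).sum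
      + ∑ p ∈ d.2.2.2.1.1, p + ∑ p ∈ d.2.2.2.2.1, p
      + ∑ c ∈ Finset.range (k + 1), (2 * d.2.1.1 (c + 1) + 1) := by
  have h1 : ((symbolOfData d).top.map Prod.fst).sum =
      (d.2.2.1.1.1.map Prod.fst).sum + ∑ c ∈ Finset.range k, (2 * d.2.1.1 (c + 1) + 1) := by
    rw [← Multiset.sum_coe, ← Multiset.map_coe, coe_top_symbolOfData, Multiset.map_add,
      Multiset.sum_add, marks, Multiset.map_map]
    rfl
  have h2 : ((symbolOfData d).bot.map Prod.fst).sum = (d.2.2.1.2.1.map Prod.fst).sum := by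
    rw [← Multiset.sum_coe, ← Multiset.map_coe, coe_bot_symbolOfData]
  rw [MarkedOddDurfeeSymbol.size, h1, h2, Finset.sum_range_succ, d.2.1.2.top (k + 1) le_rfl]
  change _ + ∑ p ∈ d.2.2.2.1.1, p + ∑ p ∈ d.2.2.2.2.1, p + (2 * d.1 + 1) = _
  ring

theorem countColor_eq (row : List (ℕ × ℕ)) (c : ℕ) :
    MarkedOddDurfeeSymbol.countColor row c =
      (row : Multiset (ℕ × ℕ)).countP fun e => e.2 = c := by
  rw [MarkedOddDurfeeSymbol.countColor, Multiset.coe_countP, List.countP_eq_length_filter]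

theorem countP_marks (k : ℕ) (n : ℕ → ℕ) (i : ℕ) :
    (marks (k + 1) n).countP (fun e => e.2 = (i : ℕ) + 1) = if i < k then 1 else 0 := by
  rw [marks, Multiset.countP_map]
  change ((Finset.range k).filter fun c => c + 1 = i + 1).card = _
  simp only [Nat.add_right_cancel_iff, Finset.filter_eq', Finset.mem_range]
  split_ifs <;> simp

/-- Each subscript below the last has exactly one mark in the top row, and it cancels the -1 in the
rank. -/
theorem rank_symbolOfData {k : ℕ} (d : SymbolData (k + 1)) (i : Fin (k + 1)) :
    (symbolOfData d).rank (i + 1) = ((d.2.2.1.1.1.countP fun e => e.2 = (i : ℕ) + 1 : ℕ) : ℤ)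
      - (d.2.2.1.2.1.countP fun e => e.2 = (i : ℕ) + 1 : ℕ) := by
  rw [MarkedOddDurfeeSymbol.rank, countColor_eq, countColor_eq, coe_top_symbolOfData,
    coe_bot_symbolOfData, Multiset.countP_add, countP_marks]
  split_ifs <;> omega

/-- The weight of a symbol in the generating function. -/
noncomputable def symbolWeight {k : ℕ} (x : Fin k → Rˣ) (a b : Rˣ) (δ : MarkedOddDurfeeSymbol k) :
    R⟦X⟧ :=
  monomial δ.size (((∏ i, x i ^ δ.rank (i + 1))
    * a ^ MarkedOddDurfeeSymbol.missing δ.t δ.lam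
    * b ^ MarkedOddDurfeeSymbol.missing δ.t δ.mu : Rˣ) : R)

theorem symbolWeight_symbolOfData {k : ℕ} (x : Fin (k + 1) → Rˣ) (y : ℕ → Rˣ)
    (hy : ∀ i : Fin (k + 1), y (i + 1) = x i) (a b : Rˣ) (d : SymbolData (k + 1)) :
    symbolWeight x a b (symbolOfData d) =
      dataWeight y (constUnit a : R⟦X⟧) (constUnit b : R⟦X⟧) d := by
  have hcolor : ∀ e ∈ cells (k + 1) d.2.1.1, 1 ≤ e.2 ∧ e.2 ≤ k + 1 := fun e he =>
    have h := cells_le d.2.1.2 he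
    ⟨h.2.2.1, h.2.2.2.1⟩
  have hrank : ∏ i, x i ^ (symbolOfData d).rank (i + 1) =
      (∏ i : Fin (k + 1), x i ^ d.2.2.1.1.1.countP fun e => e.2 = (i : ℕ) + 1)
        * ∏ i : Fin (k + 1), (x i)⁻¹ ^ d.2.2.1.2.1.countP fun e => e.2 = (i : ℕ) + 1 := by
    rw [← Finset.prod_mul_distrib]
    refine Finset.prod_congr rfl fun i _ => ?_
    rw [rank_symbolOfData, zpow_sub, zpow_natCast, zpow_natCast, inv_pow]
  have ha : ∀ u : Rˣ, (constUnit u : R⟦X⟧) = C (u : R) := fun _ => rfl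
  rw [symbolWeight, monomial_eq_C_mul_X_pow, hrank, size_symbolOfData, dataWeight,
    prod_map_entryWeight x y hy _ fun e he => hcolor e (d.2.2.1.1.2 e he),
    prod_map_entryWeight (fun i => (x i)⁻¹) (fun c => (y c)⁻¹) (fun i => by rw [hy]) _
      fun e he => hcolor e (d.2.2.1.2.2 e he), sideWeight, sideWeight, ha, ha,
    Finset.prod_pow_eq_pow_sum]
  simp only [Units.val_mul, Units.val_pow_eq_pow_val, map_mul, map_pow, pow_add]
  change _ * _ * C (a : R) ^ MarkedOddDurfeeSymbol.missing d.1 d.2.2.2.1.1 *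
    C (b : R) ^ MarkedOddDurfeeSymbol.missing d.1 d.2.2.2.2.1 * _ = _
  ring

variable [TopologicalSpace R] [DiscreteTopology R]

theorem locallyFiniteSum_symbolWeight {k : ℕ} (x : Fin (k + 1) → Rˣ) (a b : Rˣ) :
    ∃ S : R⟦X⟧,
      HasSum (markedDurfeeTerm (constUnit a) (constUnit b) (fun i => constUnit (x i)) X) S ∧
      LocallyFiniteSum (symbolWeight x a b)
        (markedDurfeePrefactor (constUnit a : R⟦X⟧) (constUnit b) X * S) := by
  -- Subscripts start at 1 while `Fin` starts at 0; the values of y at 0 and beyond the last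
  -- subscript play no role.
  let y : ℕ → Rˣ := fun c => if h : c - 1 < k + 1 then x ⟨c - 1, h⟩ else 1
  have hy : ∀ i : Fin (k + 1), y (i + 1) = x i := fun i => by
    simp only [y, Nat.add_sub_cancel, i.2, dite_true, Fin.eta]
  obtain ⟨S, h1, h2⟩ := exists_hasSum_markedDurfeeTerm k a b x y hy
  refine ⟨S, h1, ?_⟩
  let e : SymbolData (k + 1) ≃ MarkedOddDurfeeSymbol (k + 1) :=
    Equiv.ofBijective _ ⟨symbolOfData_injective, symbolOfData_surjective (Nat.succ_pos k)⟩
  have h3 := (locallyFiniteSum_dataWeight y k (constUnit a : R⟦X⟧) (constUnit b : R⟦X⟧) h2).equiv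
    e.symm
  convert h3 using 1
  funext δ
  obtain ⟨d, rfl⟩ := e.surjective δ
  rw [Function.comp_apply, Equiv.symm_apply_apply]
  exact symbolWeight_symbolOfData x y hy a b d

end Weights

/-! ### Finiteness of the counts and grouping by statistics -/

theorem finite_size_eq (k n : ℕ) : Finite {δ : MarkedOddDurfeeSymbol (k + 1) // δ.size = n} := by
  -- Over ℤ with all parameters 1 the weight of a symbol of size n is q^n, which q^(n+1) does not
  -- divide; local finiteness therefore bounds the number of such symbols.
  obtain ⟨S, -, h⟩ := locallyFiniteSum_symbolWeight (R := ℤ) (fun _ : Fin (k + 1) => 1) 1 1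
  refine ((h.locallyFinite (n + 1)).subset ?_).to_subtype
  rintro δ rfl hdvd
  have := X_pow_dvd_iff.mp hdvd δ.size (Nat.lt_succ_self _)
  simp [symbolWeight] at this

theorem finite_hasStats {k r s : ℕ} {m : Fin (k + 1) → ℤ} {n : ℕ} :
    Finite {δ : MarkedOddDurfeeSymbol (k + 1) // δ.HasStats r s m n} := by
  have := finite_size_eq k n
  exact Finite.of_injective
    (fun δ : {δ : MarkedOddDurfeeSymbol (k + 1) // δ.HasStats r s m n} =>
      (⟨δ.1, δ.2.2.2.2⟩ : {δ : MarkedOddDurfeeSymbol (k + 1) // δ.size = n}))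
    fun _ _ h => Subtype.ext (congrArg (fun z => z.1) h)

/-- The statistics of a symbol. -/
def stats {k : ℕ} (δ : MarkedOddDurfeeSymbol k) : (Fin k → ℤ) × ℕ × ℕ × ℕ :=
  (fun i => δ.rank (i + 1), MarkedOddDurfeeSymbol.missing δ.t δ.lam,
    MarkedOddDurfeeSymbol.missing δ.t δ.mu, δ.size)

theorem stats_eq_iff {k r s n : ℕ} {m : Fin k → ℤ} {δ : MarkedOddDurfeeSymbol k} :
    stats δ = (m, r, s, n) ↔ δ.HasStats r s m n := by
  simp only [stats, MarkedOddDurfeeSymbol.HasStats, Prod.mk.injEq, funext_iff]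
  tauto

/-- The weight depends only on the statistics, so each fibre of `stats` is a finite sum of equal
monomials and contributes its cardinality times that monomial. -/
theorem hasSum_stats {R : Type*} [CommRing R] [TopologicalSpace R] [DiscreteTopology R] {k : ℕ}
    (x : Fin (k + 1) → Rˣ) (a b : Rˣ) {S : R⟦X⟧} (h : HasSum (symbolWeight x a b) S) :
    HasSum (fun p : (Fin (k + 1) → ℤ) × ℕ × ℕ × ℕ =>
      match p with
      | (m, r, s, n) => markedOddDurfeeCount (k + 1) r s m n •
          monomial n (((∏ i, x i ^ m i) * a ^ r * b ^ s : Rˣ) : R)) S := by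
  have h1 := (Equiv.sigmaFiberEquiv (stats (k := k + 1))).hasSum_iff.mpr h
  refine h1.sigma ?_
  rintro ⟨m, r, s, n⟩
  have e : {δ : MarkedOddDurfeeSymbol (k + 1) // stats δ = (m, r, s, n)} ≃
      {δ : MarkedOddDurfeeSymbol (k + 1) // δ.HasStats r s m n} :=
    Equiv.subtypeEquivRight fun _ => stats_eq_iff
  have := finite_hasStats (k := k) (r := r) (s := s) (m := m) (n := n)
  have : Finite {δ : MarkedOddDurfeeSymbol (k + 1) // stats δ = (m, r, s, n)} :=
    Finite.of_equiv _ e.symm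
  let _ := Fintype.ofFinite {δ : MarkedOddDurfeeSymbol (k + 1) // stats δ = (m, r, s, n)}
  have h2 : ∀ δ : {δ : MarkedOddDurfeeSymbol (k + 1) // stats δ = (m, r, s, n)},
      symbolWeight x a b δ.1 = monomial n (((∏ i, x i ^ m i) * a ^ r * b ^ s : Rˣ) : R) := by
    rintro ⟨δ, hδ⟩
    obtain ⟨h3, h4, h5, h6⟩ := stats_eq_iff.mp hδ
    simp only [symbolWeight, h3, h4, h5, h6]
  have h3 := hasSum_fintype fun δ : {δ : MarkedOddDurfeeSymbol (k + 1) // stats δ = (m, r, s, n)} =>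
    symbolWeight x a b δ.1
  simp only [h2, Finset.sum_const, Finset.card_univ, ← Nat.card_eq_fintype_card,
    Nat.card_congr e] at h3
  convert h3 using 1
  · funext δ
    exact h2 δ
  · rfl

end OddDurfee

theorem mainTheorem8 (k : ℕ) (hk : 2 ≤ k) :
    -- every counting number is the number of elements of a finite set
    (∀ (r s : ℕ) (m : Fin k → ℤ) (n : ℕ),
      Finite {δ : MarkedOddDurfeeSymbol k // δ.HasStats r s m n}) ∧
    -- the identity of formal power series in `q`
    ∀ (R : Type*) [CommRing R] [TopologicalSpace R] [DiscreteTopology R]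
      (a b : Rˣ) (x : Fin k → Rˣ),
      ∃ S : PowerSeries R,
        HasSum (fun n : ℕ => markedDurfeeTerm (constUnit a) (constUnit b)
          (fun i => constUnit (x i)) PowerSeries.X n) S ∧
        HasSum (fun p : (Fin k → ℤ) × ℕ × ℕ × ℕ =>
            match p with
            | (m, r, s, n) => markedOddDurfeeCount k r s m n •
                PowerSeries.monomial n (((∏ i, x i ^ m i) * a ^ r * b ^ s : Rˣ) : R))
          (markedDurfeePrefactor (constUnit a : PowerSeries R) (constUnit b) PowerSeries.X * S) := by
  obtain ⟨k, rfl⟩ := Nat.exists_eq_add_of_le' (one_le_two.trans hk)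
  refine ⟨fun r s m n => OddDurfee.finite_hasStats, fun R _ _ _ a b x => ?_⟩
  obtain ⟨S, h1, h2⟩ := OddDurfee.locallyFiniteSum_symbolWeight x a b
  exact ⟨S, h1, OddDurfee.hasSum_stats x a b h2.hasSum⟩
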